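/- Let $n\ge 1$ and let $\lambda\neq 0$ be real. For $(x,u)\in\mathbb R^{2n}$ let $\pi_\lambda(x,u)$ be the unitary operator on $L^2(\mathbb R^n)$ given by $\pi_\lambda(x,u)\phi(\xi)=e^{i\lambda(x\cdot\xi+\frac12 x\cdot u)}\phi(\xi+u)$, and for $F\in L^2(\mathbb R^{2n})$ let $\pi_\lambda(F)=\int_{\mathbb R^{2n}}F(x,u)\,\pi_\lambda(x,u)\,dx\,du$ be its Weyl transform (the integral being taken in the weak sense), a bounded operator on $L^2(\mathbb R^n)$. The $\lambda$-twisted convolution on $\mathbb R^{2n}\cong\mathbb C^n$ (with $(x,u)\leftrightarrow x+iu$) is $F*_\lambda G(z)=\int_{\mathbb C^n}F(z-w)G(w)\,e^{i\frac{\lambda}{2}\operatorname{Im}(z\cdot\bar w)}\,dw$. For $t>0$ put $$p_t^\lambda(x,u)=(4\pi)^{-n}\Big(\frac{\lambda}{\sinh \lambda t}\Big)^n e^{-\frac14\lambda(\coth\lambda t)(|x|^2+|u|^2)}.$$ Let $H(\lambda)=-\Delta+\lambda^2|\xi|^2=\sum_{k\ge0}(2k+n)|\lambda|P_k(\lambda)$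 be the Hermite operator on $L^2(\mathbb R^n)$, where $P_k(\lambda)$ is the orthogonal projection onto the span of the scaled Hermite functions $\Phi_\alpha^\lambda$, $|\alpha|=k$, and let $e^{-tH(\lambda)}=\sum_{k\ge0}e^{-t(2k+n)|\lambda|}P_k(\lambda)$. Finally let $U_\lambda$ be the unitary operator on $L^2(\mathbb R^{2n})$ given by $U_\lambda f(x,u)=c^n\,\widehat f(c\,(x,u))$ with $c=\frac{\lambda}{2}\coth\frac{\lambda}{2}$, where $\widehat f(\zeta)=(2\pi)^{-n}\int_{\mathbb R^{2n}}f(v)e^{-iv\cdot\zeta}\,dv$ is the Euclidean Fourier transform, extended to $L^2(\mathbb R^{2n})$. **Proposition 4.2.** Let $f\in L^2(\mathbb R^{2n})$ be such that $\pi_\lambda(f)=e^{-\frac12H(\lambda)}M_1$ with $M_1$ a bounded linear operator on $L^2(\mathbb R^n)$, and let $g=U_\lambda f*_\lambda p_{1/2}^\lambda$. Then there is a constant $C>0$ such that $$|g(x,u)|\le C\,p_1^\lambda(x,u)\qquad\text{for all }(x,u)\in\mathbb R^{2n}.$$ If moreover $\pi_\lambda(U_\lambda f)=e^{-\frac12H(\lambda)}M_2$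 with $M_2$ a bounded linear operator on $L^2(\mathbb R^n)$ that commutes with $H(\lambda)$ (that is, $M_2$ maps the domain of $H(\lambda)$ into itself and $H(\lambda)M_2\phi=M_2H(\lambda)\phi$ there), then there is a constant $C>0$ such that $$\pi_\lambda(g)^*\pi_\lambda(g)\le C\,e^{-2H(\lambda)}$$ in the sense of quadratic forms. -/

import Mathlib

open MeasureTheory
open scoped InnerProductSpace FourierTransform

namespace TwistedFock

noncomputable section

/-- Configuration space `ℝⁿ`. -/
abbrev Conf (n : ℕ) : Type := EuclideanSpace ℝ (Fin n)

/-- Phase space `ℝ²ⁿ = ℝⁿ × ℝⁿ ≅ ℂⁿ`; a point is written `(x, u)`, or `x + i u`. -/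
abbrev Phase (n : ℕ) : Type := EuclideanSpace ℝ (Fin n ⊕ Fin n)

/-- The point `(x, u)` of phase space. -/
def mkPhase {n : ℕ} (x u : Conf n) : Phase n := WithLp.toLp 2 (Sum.elim x u)

/-- The component `x` of `(x, u)`. -/
def fstPart {n : ℕ} (v : Phase n) : Conf n := WithLp.toLp 2 fun i => v (Sum.inl i)

/-- The component `u` of `(x, u)`. -/
def sndPart {n : ℕ} (v : Phase n) : Conf n := WithLp.toLp 2 fun i => v (Sum.inr i)

/-- `L²(ℝⁿ)`. -/
abbrev L2 (n : ℕ) : Type := Lp ℂ 2 (volume : Measure (Conf n))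

/-- `L²(ℝ²ⁿ)`. -/
abbrev L2Phase (n : ℕ) : Type := Lp ℂ 2 (volume : Measure (Phase n))

/-! ### The operators `π_lam(x, u)` -/

/-- The phase `exp (i lam (x ⬝ ξ + x ⬝ u / 2))`. -/
def schrodingerPhase {n : ℕ} (lam : ℝ) (v : Phase n) (ξ : Conf n) : ℂ :=
  Complex.exp (Complex.I * (lam * (⟪fstPart v, ξ⟫_ℝ + ⟪fstPart v, sndPart v⟫_ℝ / 2) : ℝ))

theorem norm_schrodingerPhase {n : ℕ} (lam : ℝ) (v : Phase n) (ξ : Conf n) :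
    ‖schrodingerPhase lam v ξ‖ = 1 := by
  rw [schrodingerPhase, mul_comm, Complex.norm_exp_ofReal_mul_I]

theorem continuous_schrodingerPhase {n : ℕ} (lam : ℝ) (v : Phase n) :
    Continuous (schrodingerPhase lam v) := by
  unfold schrodingerPhase
  fun_prop

/-- `(π_lam(x, u) φ)(ξ) = exp (i lam (x ⬝ ξ + x ⬝ u / 2)) φ(ξ + u)`. -/
def schrodingerFun {n : ℕ} (lam : ℝ) (v : Phase n) (φ : Conf n → ℂ) (ξ : Conf n) : ℂ :=
  schrodingerPhase lam v ξ * φ (ξ + sndPart v)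

theorem memLp_schrodingerFun {n : ℕ} (lam : ℝ) (v : Phase n) (φ : L2 n) :
    MemLp (schrodingerFun lam v φ) 2 volume := by
  have h : MemLp (fun ξ : Conf n => φ (ξ + sndPart v)) 2 volume :=
    (Lp.memLp φ).comp_measurePreserving (measurePreserving_add_right volume (sndPart v))
  refine h.of_le ((continuous_schrodingerPhase lam v).aestronglyMeasurable.mul h.1)
    (Filter.Eventually.of_forall fun ξ => ?_)
  simp [schrodingerFun, norm_schrodingerPhase]

/-- `π_lam(x, u)` on `L²(ℝⁿ)`, for `v = (x, u)`. -/
def schrodinger {n : ℕ} (lam : ℝ) (v : Phase n) (φ : L2 n) : L2 n :=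
  (memLp_schrodingerFun lam v φ).toLp _

/-- `T = π_lam(F) = ∫ F(v) π_lam(v) dv`, the Weyl transform of `F`, the integral being taken in the
weak sense: `⟪ψ, T φ⟫ = ∫ F(v) ⟪ψ, π_lam(v) φ⟫ dv` for all `φ, ψ ∈ L²(ℝⁿ)`. There is at most one
such `T`. The functions `v ↦ ⟪ψ, π_lam(v) φ⟫` are in `L²(ℝ²ⁿ)`, so that for `F ∈ L²(ℝ²ⁿ)` the
integrals converge absolutely. -/
def IsWeylTransform {n : ℕ} (lam : ℝ) (F : Phase n → ℂ) (T : L2 n →L[ℂ] L2 n) : Prop :=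
  ∀ φ ψ : L2 n, Integrable (fun v => F v * ⟪ψ, schrodinger lam v φ⟫_ℂ) ∧
    ∫ v, F v * ⟪ψ, schrodinger lam v φ⟫_ℂ = ⟪ψ, T φ⟫_ℂ

/-! ### Twisted convolution and the heat kernel -/

/-- `Im (z ⬝ conj w) = u ⬝ a - x ⬝ b` for `z = x + i u` and `w = a + i b`. -/
def imForm {n : ℕ} (z w : Phase n) : ℝ :=
  ⟪sndPart z, fstPart w⟫_ℝ - ⟪fstPart z, sndPart w⟫_ℝ

/-- The `lam`-twisted convolution
`(F ∗ G)(z) = ∫ F(z - w) G(w) exp (i (lam / 2) Im (z ⬝ conj w)) dw`. -/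
def twistedConv {n : ℕ} (lam : ℝ) (F G : Phase n → ℂ) (z : Phase n) : ℂ :=
  ∫ w, F (z - w) * G w * Complex.exp (Complex.I * (lam / 2 * imForm z w : ℝ))

/-- The heat kernel `p_t^lam` of the special Hermite operator. -/
def heatKernel {n : ℕ} (lam t : ℝ) (v : Phase n) : ℝ :=
  ((4 * Real.pi) ^ n)⁻¹ * (lam / Real.sinh (lam * t)) ^ n *
    Real.exp (-(1 / 4) * lam * (Real.cosh (lam * t) / Real.sinh (lam * t)) * ‖v‖ ^ 2)

/-! ### The operator `U_lam` -/

/-- `c_t(lam) = (lam / 2) coth (t lam)`. -/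
def cConst (lam t : ℝ) : ℝ := lam / 2 * (Real.cosh (t * lam) / Real.sinh (t * lam))

/-- The Euclidean Fourier transform `(2π)⁻ⁿ ∫ f(w) exp (- i v ⬝ w) dw` on `L²(ℝ²ⁿ)`. Here `𝓕` is
Mathlib's Fourier transform on `L²`, whose kernel is `exp (- 2 π i v ⬝ w)`. -/
def euclideanFourier {n : ℕ} (f : L2Phase n) (v : Phase n) : ℂ :=
  (((2 * Real.pi) ^ n)⁻¹ : ℝ) * (𝓕 f : L2Phase n) ((2 * Real.pi)⁻¹ • v)

/-- The unitary operator `(U_{t, lam} f)(x, u) = c_t(lam)ⁿ f̂(c_t(lam) (x, u))`. -/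
def intertwiner {n : ℕ} (lam t : ℝ) (f : L2Phase n) (v : Phase n) : ℂ :=
  ((cConst lam t) ^ n : ℝ) * euclideanFourier f (cConst lam t • v)

/-- `U_lam = U_{1/2, lam}`. -/
def U {n : ℕ} (lam : ℝ) (f : L2Phase n) : Phase n → ℂ := intertwiner lam (1 / 2) f

/-! ### The Hermite operator `H(lam)` and its semigroup -/

/-- The normalised Hermite function of degree `k` on the line. Mathlib's `hermite k` is the
probabilists' polynomial `He_k`, and `He_k (√2 s) = 2 ^ (-k / 2) H_k(s)`. -/
def hermite1 (k : ℕ) (s : ℝ) : ℝ :=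
  (√((k.factorial : ℝ) * √Real.pi))⁻¹ * Polynomial.aeval (√2 * s) (Polynomial.hermite k) *
    Real.exp (-s ^ 2 / 2)

/-- The normalised scaled Hermite function
`Φ_α^lam(ξ) = |lam| ^ (n / 4) Φ_α(|lam| ^ (1 / 2) ξ)`, `α ∈ ℕⁿ`. -/
def hermiteFun {n : ℕ} (lam : ℝ) (α : Fin n → ℕ) (ξ : Conf n) : ℂ :=
  ((|lam| ^ ((n : ℝ) / 4) * ∏ i, hermite1 (α i) (√|lam| * ξ i) : ℝ) : ℂ)

theorem integrable_eval_mul_exp (q : Polynomial ℝ) {b : ℝ} (hb : 0 < b) :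
    Integrable fun s : ℝ => q.eval s * Real.exp (-b * s ^ 2) := by
  induction q using Polynomial.induction_on' with
  | add p q hp hq =>
    simp only [Polynomial.eval_add, add_mul]
    exact hp.add hq
  | monomial k a =>
    have h := (integrable_rpow_mul_exp_neg_mul_sq hb
      (s := (k : ℝ)) (by linarith [Nat.cast_nonneg (α := ℝ) k])).const_mul a
    simpa [mul_assoc] using h

theorem integrable_hermite1_sq (k : ℕ) {c : ℝ} (hc : 0 < c) :
    Integrable fun s : ℝ => hermite1 k (c * s) ^ 2 := by
  set P : Polynomial ℝ := (Polynomial.hermite k).map (Int.castRingHom ℝ) with hP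
  have h := (integrable_eval_mul_exp ((P.comp (Polynomial.C (√2 * c) * Polynomial.X)) ^ 2)
    (show 0 < c ^ 2 by positivity)).const_mul ((√((k.factorial : ℝ) * √Real.pi))⁻¹ ^ 2)
  refine h.congr (Filter.Eventually.of_forall fun s => ?_)
  have e : Real.exp (-c ^ 2 * s ^ 2) = Real.exp (-(c * s) ^ 2 / 2) ^ 2 := by
    rw [← Real.exp_nat_mul]; congr 1; push_cast; ring
  have e2 : Polynomial.aeval (√2 * (c * s)) (Polynomial.hermite k) = P.eval (√2 * c * s) := by
    rw [hP, Polynomial.eval_map, Polynomial.aeval_def, mul_assoc]; rfl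
  simp only [hermite1, e, e2, Polynomial.eval_pow, Polynomial.eval_comp, Polynomial.eval_mul,
    Polynomial.eval_C, Polynomial.eval_X]
  ring

theorem continuous_hermite1 (k : ℕ) : Continuous (hermite1 k) := by
  unfold hermite1
  have : Continuous fun s : ℝ => Polynomial.aeval (√2 * s) (Polynomial.hermite k) :=
    (Polynomial.continuous_aeval _).comp (by fun_prop)
  fun_prop

/-- The Hermite functions are square integrable. -/
theorem memLp_hermiteFun {n : ℕ} {lam : ℝ} (hlam : lam ≠ 0) (α : Fin n → ℕ) :
    MemLp (hermiteFun lam α) 2 (volume : Measure (Conf n)) := by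
  have hc : Continuous (hermiteFun (n := n) lam α) := by
    unfold hermiteFun
    have := fun i => continuous_hermite1 (α i)
    fun_prop
  rw [memLp_two_iff_integrable_sq_norm hc.aestronglyMeasurable]
  have hpos : 0 < √|lam| := Real.sqrt_pos.2 (abs_pos.2 hlam)
  have h1 : Integrable (fun y : Fin n → ℝ => ∏ i, hermite1 (α i) (√|lam| * y i) ^ 2) :=
    Integrable.fintype_prod (f := fun i s => hermite1 (α i) (√|lam| * s) ^ 2)
      fun i => integrable_hermite1_sq (α i) hpos
  have h2 := ((PiLp.volume_preserving_ofLp (Fin n)).integrable_comp_of_integrable h1).const_mul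
    ((|lam| ^ ((n : ℝ) / 4)) ^ 2)
  refine h2.congr (Filter.Eventually.of_forall fun ξ => ?_)
  simp only [hermiteFun, Function.comp, Complex.norm_real, Real.norm_eq_abs, sq_abs, mul_pow,
    Finset.prod_pow]

/-- `E_k^lam`, the span in `L²(ℝⁿ)` of the `Φ_α^lam` with `|α| = k`. -/
def hermiteSpace (n : ℕ) (lam : ℝ) (k : ℕ) : Submodule ℂ (L2 n) :=
  Submodule.span ℂ {φ | ∃ α : Fin n → ℕ, ∑ i, α i = k ∧ φ =ᵐ[volume] hermiteFun lam α}

instance finiteDimensional_hermiteSpace (n : ℕ) (lam : ℝ) (k : ℕ) :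
    FiniteDimensional ℂ (hermiteSpace n lam k) := by
  refine FiniteDimensional.span_of_finite ℂ ?_
  refine Set.Finite.subset (Set.Finite.biUnion (Finset.finite_toSet
    (Finset.piAntidiag (Finset.univ : Finset (Fin n)) k))
    (t := fun α => {φ : L2 n | φ =ᵐ[volume] hermiteFun lam α}) fun α _ => ?_) ?_
  · refine Set.Subsingleton.finite fun φ hφ ψ hψ => Lp.ext ?_
    exact Filter.EventuallyEq.trans hφ (Filter.EventuallyEq.symm hψ)
  · rintro φ ⟨α, hα, h⟩
    exact Set.mem_biUnion (x := α) (by simp [hα]) h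

/-- `P_k(lam)`, the orthogonal projection of `L²(ℝⁿ)` onto `E_k^lam`. -/
def hermiteProj (n : ℕ) (lam : ℝ) (k : ℕ) : L2 n →L[ℂ] L2 n :=
  (hermiteSpace n lam k).starProjection

/-- The eigenvalue `(2 k + n) |lam|` of `H(lam)` on `E_k^lam`. -/
def hermiteEigenvalue (n : ℕ) (lam : ℝ) (k : ℕ) : ℝ := (2 * k + n) * |lam|

/-- The self-adjoint operator `H(lam) = - Δ + lam² |ξ|² = ∑ₖ (2 k + n) |lam| P_k(lam)` on `L²(ℝⁿ)`,
an unbounded operator whose domain consists of the `φ` for which the series converges in `L²(ℝⁿ)`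
(the terms are pairwise orthogonal). -/
def hermiteOp (n : ℕ) (lam : ℝ) : L2 n →ₗ.[ℂ] L2 n where
  domain :=
    { carrier := {φ | Summable fun k : ℕ =>
        (hermiteEigenvalue n lam k : ℂ) • hermiteProj n lam k φ}
      add_mem' := fun {φ ψ} hφ hψ => by
        change Summable _
        simp only [map_add, smul_add]
        exact Summable.add hφ hψ
      zero_mem' := by
        change Summable _
        simp only [map_zero, smul_zero]
        exact summable_zero
      smul_mem' := fun c φ hφ => by
        change Summable _
        simp only [map_smul, smul_comm _ c]
        exact Summable.const_smul c hφ }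
  toFun :=
    { toFun := fun φ => ∑' k : ℕ, (hermiteEigenvalue n lam k : ℂ) • hermiteProj n lam k φ
      map_add' := fun φ ψ => by
        simpa only [Submodule.coe_add, map_add, smul_add] using Summable.tsum_add φ.2 ψ.2
      map_smul' := fun c φ => by
        simpa only [Submodule.coe_smul, map_smul, smul_comm _ c, RingHom.id_apply] using
          Summable.tsum_const_smul c φ.2 }

/-- The bounded operator `M` commutes with the unbounded operator `A`: it maps the domain of `A`
into itself, and `A M φ = M A φ` for `φ` in the domain of `A`. -/
def CommutesWith {n : ℕ} (M : L2 n →L[ℂ] L2 n) (A : L2 n →ₗ.[ℂ] L2 n) : Prop :=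
  ∀ φ : A.domain, ∃ h : M φ ∈ A.domain, A ⟨M φ, h⟩ = M (A φ)

/-- `exp (- t H(lam)) = ∑ₖ exp (- t (2 k + n) |lam|) P_k(lam)`, for `t > 0`. -/
def hermiteSemigroup (n : ℕ) (lam t : ℝ) : L2 n →L[ℂ] L2 n :=
  ∑' k : ℕ, (Real.exp (-t * hermiteEigenvalue n lam k) : ℂ) • hermiteProj n lam k

/-- The series defining `exp (- t H(lam))` converges in operator norm. -/
theorem summable_hermiteSemigroup (n : ℕ) {lam t : ℝ} (hlam : lam ≠ 0) (ht : 0 < t) :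
    Summable fun k : ℕ =>
      (Real.exp (-t * hermiteEigenvalue n lam k) : ℂ) • hermiteProj n lam k := by
  have hq : Real.exp (-t * (2 * |lam|)) < 1 := by
    rw [Real.exp_lt_one_iff]
    have := mul_pos ht (mul_pos two_pos (abs_pos.2 hlam))
    linarith
  refine Summable.of_norm_bounded ((summable_geometric_of_lt_one (Real.exp_pos _).le hq).mul_left
    (Real.exp (-t * (n * |lam|)))) fun k => ?_
  rw [norm_smul, ← Real.exp_nat_mul, ← Real.exp_add, Complex.norm_real, Real.norm_eq_abs,
    Real.abs_exp]
  refine (mul_le_of_le_one_right (Real.exp_pos _).le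
    (Submodule.starProjection_norm_le _)).trans (le_of_eq ?_)
  rw [hermiteEigenvalue]; congr 1; ring

end

end TwistedFock

/-!
The proof runs through the coherent states `e_η`, `η ∈ ℂⁿ`, the Gaussians of `cohFun`. They form a
total family (`eq_zero_of_inner_coh`: orthogonality to all of them makes the Fourier transform of
`exp (- |lam| |ξ|² / 2) φ` vanish), `π_lam(v)` moves `e_η` to a multiple of `e_{η + τ(v)}`, with
explicit matrix coefficients (`inner_coh_schrodinger`), and `exp (- t H(lam))` moves it to a
multiple of `e_{q η}`, `q = exp (- 2 t |lam|)` (`hermiteSemigroup_coh`). The last fact holds because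
`e_η` is the generating function of the Hermite functions: the degree `k` part of the reproducing
kernel `⟪e_θ, e_η⟫` is the `k`-th term of an exponential series (`inner_coh_hermiteProj_coh`).

*Pointwise bound.* By the duality `∫ (𝓕 f) Γ = ∫ f (𝓕 Γ)`, `g(z)` is a Gaussian factor in `z` times
`∫ f(v) G_z(v) dv`, where `G_z` is a Gaussian with a complex linear term
(`twistedConv_U_heatKernel`). Up to a scalar, `G_z(v)` is the trace of
`π_lam(v) exp (- H(lam) / 2) π_lam(i z)`, with `π_lam` continued to complex arguments. Formally,
`π_lam(i z)` is a positive operator, diagonal in coherent states; hence the trace is an integral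
`∫ W_z(w) ⟪e_η, π_lam(v) e_{q η}⟫ dw` over `η = τ(w)`, with a positive weight `W_z` and
`q = exp (- |lam|)` (`integral_weighted_matrixCoeff`). By Fubini, `∫ f G_z` becomes
`∫ W_z ⟪e_η, exp (- H(lam) / 2) M₁ e_{q η}⟫`. Here `exp (- H(lam) / 2)` moves to the left entry and
turns it into a multiple of `e_{q η}` as well, so that the integral is at most a constant times
`‖M₁‖ ∫ W_z ‖e_{q η}‖²`, a Gaussian integral which produces exactly the exponent of `p_1`
(`norm_integral_mul_tiltedGaussian_le`).

*Operator bound.* Between coherent states one computes `π_lam(g) = π_lam(U f) exp (- H(lam) / 2)`;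
`g` being integrable by the pointwise bound, this extends to all vectors
(`isWeylTransform_twistedConv_heatKernel`). As `M₂` commutes with the spectral projections, hence
with the semigroup (`CommutesWith.comp_hermiteSemigroup`), `π_lam(g) = M₂ exp (- H(lam))`, and the
second claim holds with any `C ≥ ‖M₂‖²`.
-/

namespace TwistedFock

noncomputable section

open scoped ComplexConjugate


/-! ### Gaussian integrals -/

theorem integrable_gaussian_sum {ι : Type*} [Fintype ι] {b : ℝ} (hb : 0 < b) (c d : ι → ℂ) :
    Integrable fun v : EuclideanSpace ℝ ι =>
      Complex.exp (∑ i, (-b * (v i : ℂ) ^ 2 + c i * v i + d i)) := by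
  have hb' : 0 < (b : ℂ).re := by simpa using hb
  have h := ((PiLp.volume_preserving_ofLp ι).integrable_comp_of_integrable
    (GaussianFourier.integrable_cexp_neg_mul_sum_add hb' c)).mul_const (Complex.exp (∑ i, d i))
  refine h.congr (Filter.Eventually.of_forall fun v => ?_)
  simp only [Function.comp, ← Complex.exp_add, Finset.mul_sum, ← Finset.sum_add_distrib]

theorem integral_gaussian_sum {ι : Type*} [Fintype ι] {b : ℝ} (hb : 0 < b) (c d : ι → ℂ) :
    ∫ v : EuclideanSpace ℝ ι, Complex.exp (∑ i, (-b * (v i : ℂ) ^ 2 + c i * v i + d i)) =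
      ((√(Real.pi / b) ^ Fintype.card ι : ℝ) : ℂ) *
        Complex.exp (∑ i, (c i ^ 2 / (4 * b) + d i)) := by
  have hb' : 0 < (b : ℂ).re := by simpa using hb
  have h := GaussianFourier.integral_cexp_neg_mul_sum_add hb' c
  have e : ((Real.pi : ℂ) / b) ^ (Fintype.card ι / 2 : ℂ) =
      ((√(Real.pi / b) ^ Fintype.card ι : ℝ) : ℂ) := by
    have h0 : 0 ≤ Real.pi / b := by positivity
    rw [Real.sqrt_eq_rpow, ← Real.rpow_natCast, ← Real.rpow_mul h0, Complex.ofReal_cpow h0]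
    push_cast
    congr 1
    ring
  rw [e] at h
  rw [Finset.sum_add_distrib, Complex.exp_add, ← mul_assoc, ← Finset.sum_div, ← h,
    ← (PiLp.volume_preserving_ofLp ι).integral_comp
      (MeasurableEquiv.toLp 2 _).symm.measurableEmbedding,
    ← integral_mul_const]
  congr 1
  ext v
  simp only [← Complex.exp_add, Finset.mul_sum, ← Finset.sum_add_distrib]

/-- Gaussian integrals over phase space, the exponent being written as a sum over the pairs of
coordinates `(xᵢ, uᵢ)`. -/
theorem integral_phase_gaussian {n : ℕ} {b : ℝ} (hb : 0 < b) (c d e : Fin n → ℂ) :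
    ∫ v : Phase n, Complex.exp (∑ i, (-b * ((v (.inl i) : ℂ) ^ 2 + (v (.inr i) : ℂ) ^ 2) +
        c i * v (.inl i) + d i * v (.inr i) + e i)) =
      (((Real.pi / b) ^ n : ℝ) : ℂ) *
        Complex.exp (∑ i, ((c i ^ 2 + d i ^ 2) / (4 * b) + e i)) := by
  have h := integral_gaussian_sum hb (Sum.elim c d) (Sum.elim e 0)
  simp only [Fintype.sum_sum_type, Sum.elim_inl, Sum.elim_inr, Fintype.card_sum, Fintype.card_fin,
    ← two_mul, pow_mul, Real.sq_sqrt (show 0 ≤ Real.pi / b by positivity),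
    ← Finset.sum_add_distrib, Pi.zero_apply] at h
  refine Eq.trans ?_ (h.trans ?_)
  · congr 1; ext v; congr 1; exact Finset.sum_congr rfl fun i _ => by ring
  · congr 2; exact Finset.sum_congr rfl fun i _ => by ring

theorem integrable_phase_gaussian {n : ℕ} {b : ℝ} (hb : 0 < b) (c d e : Fin n → ℂ) :
    Integrable fun v : Phase n => Complex.exp (∑ i,
      (-b * ((v (.inl i) : ℂ) ^ 2 + (v (.inr i) : ℂ) ^ 2) +
        c i * v (.inl i) + d i * v (.inr i) + e i)) := by
  refine (integrable_gaussian_sum hb (Sum.elim c d) (Sum.elim e 0)).congr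
    (Filter.Eventually.of_forall fun v => ?_)
  simp only [Fintype.sum_sum_type, Sum.elim_inl, Sum.elim_inr, ← Finset.sum_add_distrib,
    Pi.zero_apply]
  congr 1; exact Finset.sum_congr rfl fun i _ => by ring

theorem phase_norm_sq {n : ℕ} (v : Phase n) :
    ‖v‖ ^ 2 = ∑ i, (v (.inl i) ^ 2 + v (.inr i) ^ 2) := by
  rw [EuclideanSpace.real_norm_sq_eq, Fintype.sum_sum_type, Finset.sum_add_distrib]

theorem imForm_eq_sum {n : ℕ} (z w : Phase n) :
    imForm z w = ∑ i, (z (.inr i) * w (.inl i) - z (.inl i) * w (.inr i)) := by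
  simp [imForm, fstPart, sndPart, PiLp.inner_apply, Finset.sum_sub_distrib, mul_comm]

/-! ### Coherent states -/

/-- The coherent state
`e_η(ξ) = exp (- a |ξ|² / 2 + η ⬝ ξ - η ⬝ η / (4 a))`, `η ∈ ℂⁿ`, normalised so as to depend
holomorphically on `η`. -/
def cohFun {n : ℕ} (a : ℝ) (η : Fin n → ℂ) (ξ : Conf n) : ℂ :=
  Complex.exp (∑ i, (-(a / 2 : ℝ) * (ξ i : ℂ) ^ 2 + η i * ξ i + -(η i ^ 2 / (4 * a))))

theorem continuous_cohFun {n : ℕ} (a : ℝ) (η : Fin n → ℂ) : Continuous (cohFun a η) := by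
  unfold cohFun; fun_prop

theorem memLp_cohFun {n : ℕ} {a : ℝ} (ha : 0 < a) (η : Fin n → ℂ) :
    MemLp (cohFun a η) 2 (volume : Measure (Conf n)) := by
  rw [memLp_two_iff_integrable_sq_norm (continuous_cohFun a η).aestronglyMeasurable]
  refine (integrable_gaussian_sum ha (fun i => 2 * η i)
    (fun i => -(2 * (η i ^ 2 / (4 * a))))).norm.congr (Filter.Eventually.of_forall fun ξ => ?_)
  simp only [cohFun, ← norm_pow, ← Complex.exp_nat_mul, Finset.mul_sum]
  congr 2; refine Finset.sum_congr rfl fun i _ => ?_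
  push_cast; ring

/-- The coherent state `e_η` as an element of `L²(ℝⁿ)`. -/
def coh {n : ℕ} {a : ℝ} (ha : 0 < a) (η : Fin n → ℂ) : L2 n := (memLp_cohFun ha η).toLp _

theorem coeFn_coh {n : ℕ} {a : ℝ} (ha : 0 < a) (η : Fin n → ℂ) :
    coh ha η =ᵐ[volume] cohFun a η := MemLp.coeFn_toLp _

/-- The square of the norm of the Gaussian `e_0`. -/
def cohNorm (n : ℕ) (a : ℝ) : ℝ := √(Real.pi / a) ^ n

theorem cohNorm_pos (n : ℕ) {a : ℝ} (ha : 0 < a) : 0 < cohNorm n a := by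
  unfold cohNorm; positivity

theorem coeFn_schrodinger {n : ℕ} (lam : ℝ) (v : Phase n) (φ : L2 n) :
    schrodinger lam v φ =ᵐ[volume] schrodingerFun lam v φ := MemLp.coeFn_toLp _

theorem schrodingerFun_congr {n : ℕ} (lam : ℝ) (v : Phase n) {φ ψ : Conf n → ℂ}
    (h : φ =ᵐ[volume] ψ) : schrodingerFun lam v φ =ᵐ[volume] schrodingerFun lam v ψ := by
  filter_upwards [(measurePreserving_add_right volume (sndPart v)).quasiMeasurePreserving.ae h]
    with ξ hξ
  simp only [schrodingerFun, hξ]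

/-- The matrix coefficients of `π_lam(x, u)` between coherent states, in terms of
`τᵢ = - |lam| uᵢ + i lam xᵢ`. -/
theorem inner_coh_schrodinger {n : ℕ} {lam : ℝ} (hlam : lam ≠ 0) (θ η : Fin n → ℂ)
    (v : Phase n) :
    ⟪coh (abs_pos.2 hlam) θ, schrodinger lam v (coh (abs_pos.2 hlam) η)⟫_ℂ =
      cohNorm n |lam| * Complex.exp (∑ i, (conj (θ i) * η i / (2 * |lam| : ℝ)
        - (|lam| / 4 : ℝ) * ((v (.inl i) : ℂ) ^ 2 + (v (.inr i) : ℂ) ^ 2)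
        + (conj (θ i) * (-|lam| * v (.inr i) + Complex.I * lam * v (.inl i))
          - η i * (-|lam| * v (.inr i) - Complex.I * lam * v (.inl i))) / (2 * |lam| : ℝ))) := by
  have ha := abs_pos.2 hlam
  have hsq : ((|lam| : ℝ) : ℂ) ^ 2 = (lam : ℂ) ^ 2 := by norm_cast; exact sq_abs lam
  set a := |lam| with hadef
  have ha0 : (a : ℂ) ≠ 0 := by exact_mod_cast ha.ne'
  rw [L2.inner_def]
  have h := integral_gaussian_sum (ι := Fin n) ha
    (fun i => conj (θ i) + η i + (-a * v (.inr i) + Complex.I * lam * v (.inl i)))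
    (fun i => -(conj (θ i) ^ 2 / (4 * a)) - η i ^ 2 / (4 * a) - (a / 2 : ℝ) * (v (.inr i) : ℂ) ^ 2
      + η i * v (.inr i) + Complex.I * lam * (v (.inl i) * v (.inr i) / 2))
  rw [Fintype.card_fin] at h
  refine Eq.trans (integral_congr_ae ?_) (h.trans ?_)
  · filter_upwards [coeFn_coh ha θ, coeFn_schrodinger lam v (coh ha η),
      schrodingerFun_congr lam v (coeFn_coh ha η)] with ξ h1 h2 h3
    rw [h1, h2, h3]
    simp only [schrodingerFun, cohFun, schrodingerPhase, RCLike.inner_apply, ← Complex.exp_conj,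
      ← Complex.exp_add, fstPart, sndPart, PiLp.inner_apply, map_sum, Complex.ofReal_add,
      Complex.ofReal_mul, Complex.ofReal_sum, Finset.mul_sum, ← Finset.sum_add_distrib,
      Finset.sum_div, Complex.ofReal_div]
    congr 1
    refine Finset.sum_congr rfl fun i _ => ?_
    simp only [map_add, map_mul, map_neg, map_pow, map_div₀, Complex.conj_ofReal, PiLp.add_apply,
      RCLike.conj_to_real, map_ofNat]
    push_cast
    ring
  · rw [cohNorm]
    congr 2
    refine Finset.sum_congr rfl fun i _ => ?_
    push_cast
    simp only [← hadef]
    field_simp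
    ring_nf
    simp only [Complex.I_sq, ← hsq]
    ring

theorem schrodinger_zero {n : ℕ} (lam : ℝ) (φ : L2 n) : schrodinger lam 0 φ = φ := by
  refine Lp.ext ((coeFn_schrodinger lam 0 φ).trans (Filter.Eventually.of_forall fun ξ => ?_))
  have h1 : fstPart (0 : Phase n) = 0 := by ext; simp [fstPart]
  have h2 : sndPart (0 : Phase n) = 0 := by ext; simp [sndPart]
  simp [schrodingerFun, schrodingerPhase, h1, h2]

theorem inner_coh_coh {n : ℕ} {lam : ℝ} (hlam : lam ≠ 0) (θ η : Fin n → ℂ) :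
    ⟪coh (abs_pos.2 hlam) θ, coh (abs_pos.2 hlam) η⟫_ℂ =
      cohNorm n |lam| * Complex.exp (∑ i, conj (θ i) * η i / (2 * |lam| : ℝ)) := by
  have h := inner_coh_schrodinger hlam θ η 0
  rw [schrodinger_zero] at h
  simpa using h

theorem norm_sq_coh {n : ℕ} {lam : ℝ} (hlam : lam ≠ 0) (η : Fin n → ℂ) :
    ‖coh (abs_pos.2 hlam) η‖ ^ 2 =
      cohNorm n |lam| * Real.exp (∑ i, ‖η i‖ ^ 2 / (2 * |lam|)) := by
  have h := inner_self_eq_norm_sq_to_K (𝕜 := ℂ) (coh (abs_pos.2 hlam) η)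
  rw [inner_coh_coh hlam] at h
  have h' : ((cohNorm n |lam| * Real.exp (∑ i, ‖η i‖ ^ 2 / (2 * |lam|)) : ℝ) : ℂ) =
      ((‖coh (abs_pos.2 hlam) η‖ ^ 2 : ℝ) : ℂ) := by
    simp only [Complex.conj_mul'] at h
    push_cast at h ⊢
    exact h
  exact_mod_cast h'.symm

/-! ### Linearity, unitarity and measurability of `π_lam(v)` -/

theorem norm_schrodinger {n : ℕ} (lam : ℝ) (v : Phase n) (φ : L2 n) :
    ‖schrodinger lam v φ‖ = ‖φ‖ := by
  rw [schrodinger, Lp.norm_toLp, Lp.norm_def,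
    ← eLpNorm_comp_measurePreserving (Lp.memLp φ).1
      (measurePreserving_add_right volume (sndPart v))]
  congr 1
  exact eLpNorm_congr_norm_ae (Filter.Eventually.of_forall fun ξ => by
    simp [schrodingerFun, norm_schrodingerPhase])

theorem schrodinger_add {n : ℕ} (lam : ℝ) (v : Phase n) (φ ψ : L2 n) :
    schrodinger lam v (φ + ψ) = schrodinger lam v φ + schrodinger lam v ψ := by
  refine Lp.ext ?_
  filter_upwards [coeFn_schrodinger lam v (φ + ψ), coeFn_schrodinger lam v φ,
    coeFn_schrodinger lam v ψ, schrodingerFun_congr lam v (Lp.coeFn_add φ ψ),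
    Lp.coeFn_add (schrodinger lam v φ) (schrodinger lam v ψ)] with ξ h1 h2 h3 h4 h5
  rw [h5, Pi.add_apply, h1, h2, h3, h4]
  simp only [schrodingerFun, Pi.add_apply, mul_add]

theorem schrodinger_smul {n : ℕ} (lam : ℝ) (v : Phase n) (c : ℂ) (φ : L2 n) :
    schrodinger lam v (c • φ) = c • schrodinger lam v φ := by
  refine Lp.ext ?_
  filter_upwards [coeFn_schrodinger lam v (c • φ), coeFn_schrodinger lam v φ,
    schrodingerFun_congr lam v (Lp.coeFn_smul c φ),
    Lp.coeFn_smul c (schrodinger lam v φ)] with ξ h1 h2 h4 h5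
  rw [h5, Pi.smul_apply, h1, h2, h4]
  simp only [schrodingerFun, Pi.smul_apply, smul_eq_mul, mul_left_comm]

theorem stronglyMeasurable_inner_schrodinger {n : ℕ} (lam : ℝ) (φ ψ : L2 n) :
    StronglyMeasurable fun v : Phase n => ⟪ψ, schrodinger lam v φ⟫_ℂ := by
  have e : (fun v : Phase n => ⟪ψ, schrodinger lam v φ⟫_ℂ) =
      fun v => ∫ ξ, schrodingerPhase lam v ξ * φ (ξ + sndPart v) * conj (ψ ξ) := by
    ext v
    rw [L2.inner_def]
    refine integral_congr_ae ?_
    filter_upwards [coeFn_schrodinger lam v φ] with ξ h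
    rw [h, RCLike.inner_apply, schrodingerFun]
  rw [e]
  have hs : Continuous (sndPart : Phase n → Conf n) := by unfold sndPart; fun_prop
  have hf : Continuous (fstPart : Phase n → Conf n) := by unfold fstPart; fun_prop
  refine StronglyMeasurable.integral_prod_right
    (f := fun v ξ => schrodingerPhase lam v ξ * φ (ξ + sndPart v) * conj (ψ ξ)) ?_
  refine StronglyMeasurable.mul (StronglyMeasurable.mul ?_ ?_) ?_
  · refine Continuous.stronglyMeasurable ?_
    simp only [schrodingerPhase]
    fun_prop
  · exact (Lp.stronglyMeasurable φ).comp_measurable (Continuous.measurable (by fun_prop))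
  · exact Complex.continuous_conj.comp_stronglyMeasurable
      ((Lp.stronglyMeasurable ψ).comp_measurable measurable_snd)


/-! ### Totality of the coherent states -/

theorem integral_fourier_mul_of_integrable {V : Type*} [NormedAddCommGroup V]
    [InnerProductSpace ℝ V] [FiniteDimensional ℝ V] [MeasurableSpace V] [BorelSpace V]
    {f g : V → ℂ} (hf : Integrable f) (hg : Integrable g) :
    ∫ ξ, 𝓕 f ξ * g ξ = ∫ x, f x * 𝓕 g x := by
  simpa using! VectorFourier.integral_fourierIntegral_smul_eq_flip (L := innerₗ V)
    Real.continuous_fourierChar continuous_inner hf hg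

/-- An integrable function whose Fourier transform vanishes identically is null: it is orthogonal
to every Schwartz function, each of these being a Fourier transform. -/
theorem ae_eq_zero_of_fourier_eq_zero {V : Type*} [NormedAddCommGroup V]
    [InnerProductSpace ℝ V] [FiniteDimensional ℝ V] [MeasurableSpace V] [BorelSpace V]
    {h : V → ℂ} (hi : Integrable h) (hF : ∀ y, 𝓕 h y = 0) : ∀ᵐ ξ, h ξ = 0 := by
  refine ae_eq_zero_of_integral_contDiff_smul_eq_zero hi.locallyIntegrable fun g hg hc => ?_
  have hg₁ : HasCompactSupport (Complex.ofRealCLM ∘ g) := hc.comp_left rfl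
  have hg₂ : ContDiff ℝ (⊤ : ℕ∞) (Complex.ofRealCLM ∘ g) := by fun_prop
  set G : SchwartzMap V ℂ := hg₁.toSchwartzMap hg₂ with hG
  have key := integral_fourier_mul_of_integrable
    ((𝓕⁻ G : SchwartzMap V ℂ).integrable (μ := volume)) hi
  have e1 : 𝓕 (𝓕⁻ G : SchwartzMap V ℂ) = G := FourierTransform.fourier_fourierInv_eq G
  rw [← SchwartzMap.fourier_coe, e1] at key
  simpa [hF, hG] using key

/-- The coherent states are total in `L²(ℝⁿ)`; those with purely imaginary parameter suffice. -/
theorem eq_zero_of_inner_coh {n : ℕ} {a : ℝ} (ha : 0 < a) (φ : L2 n)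
    (h : ∀ η : Fin n → ℂ, ⟪coh ha η, φ⟫_ℂ = 0) : φ = 0 := by
  have hi : Integrable fun ξ => cohFun a (0 : Fin n → ℂ) ξ * φ ξ :=
    (memLp_cohFun ha 0).integrable_mul (Lp.memLp φ)
  refine (Lp.eq_zero_iff_ae_eq_zero).2 ?_
  have hF : ∀ y, 𝓕 (fun ξ => cohFun a (0 : Fin n → ℂ) ξ * φ ξ) y = 0 := by
    intro y
    set η : Fin n → ℂ := fun i => 2 * Real.pi * Complex.I * y i with hη
    have h' := h η
    rw [L2.inner_def] at h'
    have e : ∀ᵐ ξ : Conf n, ⟪coh ha η ξ, φ ξ⟫_ℂ =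
        Complex.exp (∑ i, -(conj (η i) ^ 2 / (4 * a))) *
        (Complex.exp ((-2 * Real.pi * ⟪ξ, y⟫_ℝ : ℝ) * Complex.I) •
          (cohFun a (0 : Fin n → ℂ) ξ * φ ξ)) := by
      filter_upwards [coeFn_coh ha η] with ξ hξ
      rw [hξ]
      simp only [RCLike.inner_apply, cohFun, ← Complex.exp_conj, smul_eq_mul]
      rw [mul_comm (φ ξ), ← mul_assoc, ← mul_assoc, ← Complex.exp_add, ← Complex.exp_add]
      congr 2
      simp only [PiLp.inner_apply, map_sum, Finset.mul_sum, Complex.ofReal_sum, Finset.sum_mul,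
        ← Finset.sum_add_distrib]
      refine Finset.sum_congr rfl fun i _ => ?_
      simp [hη, map_ofNat (starRingEnd ℂ)]
      ring
    rw [integral_congr_ae e, integral_const_mul] at h'
    rw [Real.fourier_eq']
    exact (mul_eq_zero.1 h').resolve_left (Complex.exp_ne_zero _)
  filter_upwards [ae_eq_zero_of_fourier_eq_zero hi hF] with ξ hξ
  exact (mul_eq_zero.1 hξ).resolve_left (Complex.exp_ne_zero _)

/-! ### Hermite polynomials and Gaussian integrals on the line -/

/-- The probabilists' Hermite polynomial, with real coefficients. -/
def hermitePoly (k : ℕ) : Polynomial ℝ := (Polynomial.hermite k).map (Int.castRingHom ℝ)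

theorem hermitePoly_succ (k : ℕ) :
    hermitePoly (k + 1) = Polynomial.X * hermitePoly k - Polynomial.derivative (hermitePoly k) := by
  simp [hermitePoly, Polynomial.hermite_succ, Polynomial.derivative_map]

theorem hermitePoly_zero : hermitePoly 0 = 1 := by simp [hermitePoly]

theorem derivative_hermitePoly_succ (k : ℕ) :
    Polynomial.derivative (hermitePoly (k + 1)) = (k + 1 : Polynomial ℝ) * hermitePoly k := by
  induction k with
  | zero => simp [hermitePoly_succ, hermitePoly_zero]
  | succ k ih =>
    rw [hermitePoly_succ (k + 1), Polynomial.derivative_sub, Polynomial.derivative_mul, ih,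
      Polynomial.derivative_mul, Polynomial.derivative_X, hermitePoly_succ k]
    have : Polynomial.derivative ((k : Polynomial ℝ) + 1) = 0 := by simp
    rw [this]
    push_cast
    ring

theorem hermite1_eq (k : ℕ) (s : ℝ) : hermite1 k s =
    (√((k.factorial : ℝ) * √Real.pi))⁻¹ * (hermitePoly k).eval (√2 * s) *
      Real.exp (-s ^ 2 / 2) := by
  rw [hermite1, hermitePoly, Polynomial.eval_map, Polynomial.aeval_def]; rfl

/-- The weight `exp (- x² / 2 + θ x)`. -/
def tiltedWeight (θ : ℂ) (x : ℝ) : ℂ := Complex.exp (-(x : ℂ) ^ 2 / 2 + θ * x)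

theorem integrable_poly_tiltedWeight (P : Polynomial ℝ) (θ : ℂ) :
    Integrable fun x : ℝ => ((P.eval x : ℝ) : ℂ) * tiltedWeight θ x := by
  have h := (integrable_eval_mul_exp P (show (0 : ℝ) < 1 / 4 by norm_num)).norm.const_mul
    (Real.exp (θ.re ^ 2))
  refine h.mono' (by unfold tiltedWeight; fun_prop) (Filter.Eventually.of_forall fun x => ?_)
  rw [norm_mul, tiltedWeight, Complex.norm_exp, Complex.norm_real, norm_mul, mul_left_comm,
    Real.norm_eq_abs (Real.exp _), Real.abs_exp, ← Real.exp_add]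
  refine mul_le_mul_of_nonneg_left (Real.exp_le_exp.2 ?_) (norm_nonneg _)
  have : (-(x : ℂ) ^ 2 / 2 + θ * x).re = -x ^ 2 / 2 + θ.re * x := by
    have : (-(x : ℂ) ^ 2 / 2) = ((-x ^ 2 / 2 : ℝ) : ℂ) := by push_cast; ring
    rw [this, Complex.add_re, Complex.ofReal_re, Complex.re_mul_ofReal]
  rw [this]
  nlinarith [sq_nonneg (x / 2 - θ.re)]

/-- Integration by parts against the recursion of the Hermite polynomials. -/
theorem integral_hermitePoly_succ_mul (k : ℕ) (P : Polynomial ℝ) (θ : ℂ) :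
    ∫ x : ℝ, (((hermitePoly (k + 1) * P).eval x : ℝ) : ℂ) * tiltedWeight θ x =
      (∫ x : ℝ, (((hermitePoly k * Polynomial.derivative P).eval x : ℝ) : ℂ) * tiltedWeight θ x) +
      θ * ∫ x : ℝ, (((hermitePoly k * P).eval x : ℝ) : ℂ) * tiltedWeight θ x := by
  have i1 := integrable_poly_tiltedWeight (hermitePoly (k + 1) * P) θ
  have i2 := integrable_poly_tiltedWeight (hermitePoly k * Polynomial.derivative P) θ
  have i3 := integrable_poly_tiltedWeight (hermitePoly k * P) θ
  have hd : ∀ x : ℝ, HasDerivAt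
      (fun x : ℝ => (((hermitePoly k * P).eval x : ℝ) : ℂ) * tiltedWeight θ x)
      ((((hermitePoly k * Polynomial.derivative P).eval x : ℝ) : ℂ) * tiltedWeight θ x +
        θ * ((((hermitePoly k * P).eval x : ℝ) : ℂ) * tiltedWeight θ x) -
        (((hermitePoly (k + 1) * P).eval x : ℝ) : ℂ) * tiltedWeight θ x) x := by
    intro x
    have h1 := ((hermitePoly k * P).hasDerivAt x).ofReal_comp
    have h2 : HasDerivAt (tiltedWeight θ) (tiltedWeight θ x * (-x + θ)) x := by
      have hx : HasDerivAt (fun y : ℝ => (y : ℂ)) 1 x := Complex.ofRealCLM.hasDerivAt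
      have := (((hx.pow 2).neg.div_const 2).add (hx.const_mul θ)).cexp
      convert! this using 1
      simp [tiltedWeight]
      ring
    refine (h1.mul h2).congr_deriv ?_
    rw [hermitePoly_succ]
    simp only [Polynomial.derivative_mul, Polynomial.eval_mul, Polynomial.eval_add,
      Polynomial.eval_sub, Polynomial.eval_X]
    push_cast
    ring
  have h0 := integral_eq_zero_of_hasDerivAt_of_integrable hd ((i2.add (i3.const_mul θ)).sub i1) i3
  rw [integral_sub (by exact i2.add (i3.const_mul θ)) i1, integral_add i2 (i3.const_mul θ),
    integral_const_mul, sub_eq_zero] at h0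
  exact h0.symm

theorem integral_tiltedWeight (θ : ℂ) :
    ∫ x : ℝ, tiltedWeight θ x = (√(2 * Real.pi) : ℝ) * Complex.exp (θ ^ 2 / 2) := by
  have h := integral_cexp_quadratic (b := -(1 / 2 : ℂ)) (by norm_num) θ 0
  have e : ((Real.pi : ℂ) / -(-(1 / 2 : ℂ))) ^ (1 / 2 : ℂ) = ((√(2 * Real.pi) : ℝ) : ℂ) := by
    rw [Real.sqrt_eq_rpow, Complex.ofReal_cpow (by positivity)]
    push_cast
    congr 1; ring
  rw [e] at h
  refine Eq.trans ?_ (h.trans ?_)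
  · congr 1; ext x; rw [tiltedWeight]; congr 1; ring
  · congr 2; ring

theorem integral_hermitePoly_tiltedWeight (k : ℕ) (θ : ℂ) :
    ∫ x : ℝ, (((hermitePoly k).eval x : ℝ) : ℂ) * tiltedWeight θ x =
      (√(2 * Real.pi) : ℝ) * Complex.exp (θ ^ 2 / 2) * θ ^ k := by
  induction k with
  | zero => simp [hermitePoly_zero, integral_tiltedWeight]
  | succ k ih =>
    have h := integral_hermitePoly_succ_mul k 1 θ
    simp only [mul_one, Polynomial.derivative_one, mul_zero, Polynomial.eval_zero,
      Complex.ofReal_zero, zero_mul, integral_zero, zero_add] at h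
    rw [h, ih]; ring

theorem integral_hermitePoly_mul (j k : ℕ) :
    ∫ x : ℝ, (((hermitePoly j * hermitePoly k).eval x : ℝ) : ℂ) * tiltedWeight 0 x =
      if j = k then ((k.factorial * √(2 * Real.pi) : ℝ) : ℂ) else 0 := by
  induction j generalizing k with
  | zero =>
    have h := integral_hermitePoly_tiltedWeight k 0
    rw [hermitePoly_zero, one_mul, h]
    rcases k with _ | k <;> simp
  | succ j ih =>
    have h := integral_hermitePoly_succ_mul j (hermitePoly k) 0
    rw [zero_mul, add_zero] at h
    rw [h]
    rcases k with _ | k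
    · simp [hermitePoly_zero]
    · have e : ∀ x : ℝ, (((hermitePoly j * Polynomial.derivative (hermitePoly (k + 1))).eval x : ℝ)
          : ℂ) * tiltedWeight 0 x =
          (k + 1) * ((((hermitePoly j * hermitePoly k).eval x : ℝ) : ℂ) * tiltedWeight 0 x) := by
        intro x
        rw [derivative_hermitePoly_succ]
        simp only [Polynomial.eval_mul, Polynomial.eval_add, Polynomial.eval_natCast,
          Polynomial.eval_one]
        push_cast; ring
      simp only [e, integral_const_mul, ih, Nat.add_right_cancel_iff]
      split_ifs
      · rw [Nat.factorial_succ]; push_cast; ring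
      · simp

theorem integral_hermite1_mul {a : ℝ} (ha : 0 < a) (j k : ℕ) :
    ∫ s : ℝ, hermite1 j (√a * s) * hermite1 k (√a * s) = if j = k then (√a)⁻¹ else 0 := by
  -- The substitution `x = √2 √a s` leads to Mathlib's normalisation of the Hermite polynomials.
  set F : ℝ → ℝ := fun x => (√((j.factorial : ℝ) * √Real.pi))⁻¹ *
    (√((k.factorial : ℝ) * √Real.pi))⁻¹ * ((hermitePoly j * hermitePoly k).eval x *
      Real.exp (-x ^ 2 / 2)) with hF
  have e : ∀ s, hermite1 j (√a * s) * hermite1 k (√a * s) = F (√2 * √a * s) := by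
    intro s
    simp only [hermite1_eq, hF, Polynomial.eval_mul]
    have : Real.exp (-(√2 * √a * s) ^ 2 / 2) =
        Real.exp (-(√a * s) ^ 2 / 2) * Real.exp (-(√a * s) ^ 2 / 2) := by
      rw [← Real.exp_add, mul_assoc √2, mul_pow √2, Real.sq_sqrt zero_le_two]; congr 1; ring
    rw [this, mul_assoc √2]; ring
  have hI : ∫ x : ℝ, (hermitePoly j * hermitePoly k).eval x * Real.exp (-x ^ 2 / 2) =
      if j = k then (k.factorial * √(2 * Real.pi) : ℝ) else 0 := by
    have h := integral_hermitePoly_mul j k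
    have e2 : ∀ x : ℝ, (((hermitePoly j * hermitePoly k).eval x : ℝ) : ℂ) * tiltedWeight 0 x =
        (((hermitePoly j * hermitePoly k).eval x * Real.exp (-x ^ 2 / 2) : ℝ) : ℂ) := by
      intro x; simp [tiltedWeight]
    simp only [e2] at h
    rw [integral_complex_ofReal] at h
    split_ifs at h ⊢ with hjk <;> exact_mod_cast h
  simp only [e]
  rw [Measure.integral_comp_mul_left F, hF, integral_const_mul, hI]
  split_ifs with hjk
  · subst hjk
    have h2 : (√((j.factorial : ℝ) * √Real.pi))⁻¹ * (√((j.factorial : ℝ) * √Real.pi))⁻¹ =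
        ((j.factorial : ℝ) * √Real.pi)⁻¹ := by
      rw [← mul_inv, Real.mul_self_sqrt (by positivity)]
    rw [h2, abs_of_pos (by positivity), Real.sqrt_mul zero_le_two, smul_eq_mul]
    field_simp
  · simp

theorem integral_hermite1_mul_gaussian {a : ℝ} (ha : 0 < a) (k : ℕ) (η : ℂ) :
    ∫ s : ℝ, (hermite1 k (√a * s) : ℂ) *
        Complex.exp (-(a / 2 : ℝ) * (s : ℂ) ^ 2 + η * s + -(η ^ 2 / (4 * a))) =
      ((√((k.factorial : ℝ) * √Real.pi))⁻¹ * √(Real.pi / a) : ℝ) * (η / √(2 * a)) ^ k := by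
  have h2a : 0 < √(2 * a) := Real.sqrt_pos.2 (by positivity)
  have h2a' : ((√(2 * a) : ℝ) : ℂ) ≠ 0 := by exact_mod_cast h2a.ne'
  have hsq : ((√(2 * a) : ℝ) : ℂ) ^ 2 = 2 * a := by
    norm_cast; rw [Real.sq_sqrt (by positivity)]
  set F : ℝ → ℂ := fun x => ((√((k.factorial : ℝ) * √Real.pi))⁻¹ : ℝ) *
    Complex.exp (-(η ^ 2 / (4 * a))) *
    ((((hermitePoly k).eval x : ℝ) : ℂ) * tiltedWeight (η / √(2 * a)) x) with hF
  have e : ∀ s : ℝ, (hermite1 k (√a * s) : ℂ) *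
      Complex.exp (-(a / 2 : ℝ) * (s : ℂ) ^ 2 + η * s + -(η ^ 2 / (4 * a))) =
      F (√(2 * a) * s) := by
    intro s
    have e1 : Real.exp (-(√a * s) ^ 2 / 2) = Real.exp (-(a / 2) * s ^ 2) := by
      rw [mul_pow, Real.sq_sqrt ha.le]; congr 1; ring
    simp only [hermite1_eq, hF, e1, tiltedWeight, ← mul_assoc √2, ← Real.sqrt_mul zero_le_two]
    push_cast
    have e2 : Complex.exp (-(a / 2) * (s : ℂ) ^ 2) *
        Complex.exp (-(a / 2) * (s : ℂ) ^ 2 + η * s + -(η ^ 2 / (4 * a))) =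
        Complex.exp (-(η ^ 2 / (4 * a))) *
        Complex.exp (-((√(2 * a) : ℝ) * (s : ℂ)) ^ 2 / 2 +
          η / (√(2 * a) : ℝ) * ((√(2 * a) : ℝ) * s)) := by
      rw [← Complex.exp_add, ← Complex.exp_add, mul_pow, hsq]
      congr 1
      field_simp
      ring
    linear_combination (((√((k.factorial : ℝ) * √Real.pi) : ℝ) : ℂ)⁻¹ *
      ((hermitePoly k).eval (√(2 * a) * s) : ℝ)) * e2
  simp only [e]
  rw [Measure.integral_comp_mul_left F, hF, integral_const_mul, integral_hermitePoly_tiltedWeight,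
    abs_of_pos (by positivity), div_pow, hsq]
  have e3 : Complex.exp (-(η ^ 2 / (4 * a))) * Complex.exp (η ^ 2 / (2 * a) / 2) = 1 := by
    rw [← Complex.exp_add, ← Complex.exp_zero]; congr 1; field_simp; ring
  have e4 : √(Real.pi / a) = (√(2 * a))⁻¹ * √(2 * Real.pi) := by
    rw [← Real.sqrt_inv, ← Real.sqrt_mul (by positivity)]; congr 1; field_simp
  rw [e4, Complex.real_smul]
  push_cast
  linear_combination ((√(2 * a) : ℝ) : ℂ)⁻¹ * ((√((k.factorial : ℝ) * √Real.pi) : ℝ) : ℂ)⁻¹ *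
    (√(2 * Real.pi) : ℝ) * (η / √(2 * a)) ^ k * e3


/-! ### Hermite functions and the spectral projections -/

theorem integral_conf_prod {n : ℕ} (F : Fin n → ℝ → ℂ) :
    ∫ ξ : Conf n, ∏ i, F i (ξ i) = ∏ i, ∫ s, F i s := by
  rw [← integral_fintype_prod_volume_eq_prod F]
  exact (PiLp.volume_preserving_ofLp (Fin n)).integral_comp
    (MeasurableEquiv.toLp 2 _).symm.measurableEmbedding (fun y : Fin n → ℝ => ∏ i, F i (y i))

/-- The Hermite function `Φ_α^lam` as an element of `L²(ℝⁿ)`. -/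
def hermiteL2 {n : ℕ} {lam : ℝ} (hlam : lam ≠ 0) (α : Fin n → ℕ) : L2 n :=
  (memLp_hermiteFun hlam α).toLp _

theorem coeFn_hermiteL2 {n : ℕ} {lam : ℝ} (hlam : lam ≠ 0) (α : Fin n → ℕ) :
    hermiteL2 hlam α =ᵐ[volume] hermiteFun lam α := MemLp.coeFn_toLp _

theorem rpow_quarter_sq (n : ℕ) {a : ℝ} (ha : 0 < a) :
    a ^ ((n : ℝ) / 4) * a ^ ((n : ℝ) / 4) = √a ^ n := by
  rw [← Real.rpow_add ha, Real.sqrt_eq_rpow, ← Real.rpow_natCast, ← Real.rpow_mul ha.le]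
  congr 1; ring

theorem inner_hermiteL2 {n : ℕ} {lam : ℝ} (hlam : lam ≠ 0) (α β : Fin n → ℕ) :
    ⟪hermiteL2 hlam α, hermiteL2 hlam β⟫_ℂ = if α = β then 1 else 0 := by
  have ha := abs_pos.2 hlam
  rw [L2.inner_def]
  have e : ∀ᵐ ξ : Conf n, ⟪hermiteL2 hlam α ξ, hermiteL2 hlam β ξ⟫_ℂ =
      ((√|lam| ^ n : ℝ) : ℂ) *
        ∏ i, ((hermite1 (α i) (√|lam| * ξ i) * hermite1 (β i) (√|lam| * ξ i) : ℝ) : ℂ) := by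
    filter_upwards [coeFn_hermiteL2 hlam α, coeFn_hermiteL2 hlam β] with ξ h1 h2
    rw [h1, h2, RCLike.inner_apply, hermiteFun, hermiteFun, Complex.conj_ofReal,
      ← rpow_quarter_sq n ha]
    push_cast
    rw [Finset.prod_mul_distrib]
    ring
  rw [integral_congr_ae e, integral_const_mul, integral_conf_prod
    (fun i s => ((hermite1 (α i) (√|lam| * s) * hermite1 (β i) (√|lam| * s) : ℝ) : ℂ))]
  simp only [integral_complex_ofReal, integral_hermite1_mul ha]
  split_ifs with h
  · subst h
    simp only [if_true, Finset.prod_const, Finset.card_univ, Fintype.card_fin]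
    have : ((√|lam| : ℝ) : ℂ) ≠ 0 := by exact_mod_cast (Real.sqrt_pos.2 ha).ne'
    push_cast
    rw [← mul_pow, mul_inv_cancel₀ this, one_pow]
  · obtain ⟨i, hi⟩ := Function.ne_iff.1 h
    rw [Finset.prod_eq_zero (Finset.mem_univ i) (by simp [hi]), mul_zero]

theorem inner_hermiteL2_coh {n : ℕ} {lam : ℝ} (hlam : lam ≠ 0) (α : Fin n → ℕ)
    (η : Fin n → ℂ) :
    ⟪hermiteL2 hlam α, coh (abs_pos.2 hlam) η⟫_ℂ = ((|lam| ^ ((n : ℝ) / 4) : ℝ) : ℂ) *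
      ∏ i, (((√(((α i).factorial : ℝ) * √Real.pi))⁻¹ * √(Real.pi / |lam|) : ℝ) *
        (η i / √(2 * |lam|)) ^ α i) := by
  have ha := abs_pos.2 hlam
  rw [L2.inner_def]
  have e : ∀ᵐ ξ : Conf n, ⟪hermiteL2 hlam α ξ, coh (abs_pos.2 hlam) η ξ⟫_ℂ =
      ((|lam| ^ ((n : ℝ) / 4) : ℝ) : ℂ) * ∏ i, ((hermite1 (α i) (√|lam| * ξ i) : ℂ) *
        Complex.exp (-(|lam| / 2 : ℝ) * (ξ i : ℂ) ^ 2 + η i * ξ i + -(η i ^ 2 / (4 * |lam|)))) := by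
    filter_upwards [coeFn_hermiteL2 hlam α, coeFn_coh (abs_pos.2 hlam) η] with ξ h1 h2
    rw [h1, h2, RCLike.inner_apply, hermiteFun, cohFun, Complex.conj_ofReal,
      Finset.prod_mul_distrib, Complex.exp_sum]
    push_cast
    ring
  rw [integral_congr_ae e, integral_const_mul, integral_conf_prod
    (fun i s => (hermite1 (α i) (√|lam| * s) : ℂ) *
        Complex.exp (-(|lam| / 2 : ℝ) * (s : ℂ) ^ 2 + η i * s + -(η i ^ 2 / (4 * |lam|))))]
  simp only [integral_hermite1_mul_gaussian ha]

theorem hermiteSpace_eq_span {n : ℕ} {lam : ℝ} (hlam : lam ≠ 0) (k : ℕ) :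
    hermiteSpace n lam k = Submodule.span ℂ
      (hermiteL2 hlam '' {α : Fin n → ℕ | ∑ i, α i = k}) := by
  rw [hermiteSpace]
  congr 1
  ext φ
  constructor
  · rintro ⟨α, hα, h⟩
    exact ⟨α, hα, Lp.ext ((coeFn_hermiteL2 hlam α).trans h.symm)⟩
  · rintro ⟨α, hα, rfl⟩
    exact ⟨α, hα, coeFn_hermiteL2 hlam α⟩

theorem hermiteProj_apply {n : ℕ} {lam : ℝ} (hlam : lam ≠ 0) (k : ℕ) (φ : L2 n) :
    hermiteProj n lam k φ = ∑ α ∈ Finset.piAntidiag (Finset.univ : Finset (Fin n)) k,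
      ⟪hermiteL2 hlam α, φ⟫_ℂ • hermiteL2 hlam α := by
  refine Submodule.eq_starProjection_of_mem_of_inner_eq_zero ?_ fun w hw => ?_
  · rw [hermiteSpace_eq_span hlam]
    refine Submodule.sum_mem _ fun α hα => Submodule.smul_mem _ _ (Submodule.subset_span ?_)
    exact ⟨α, by simpa using hα, rfl⟩
  · rw [hermiteSpace_eq_span hlam] at hw
    induction hw using Submodule.span_induction with
    | mem x hx =>
      obtain ⟨β, hβ, rfl⟩ := hx
      have hβ' : β ∈ Finset.piAntidiag (Finset.univ : Finset (Fin n)) k := by simpa using hβ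
      simp only [inner_sub_left, sum_inner, inner_smul_left, inner_hermiteL2, inner_conj_symm,
        mul_ite, mul_one, mul_zero, Finset.sum_ite_eq', hβ', if_true, sub_self]
    | zero => simp
    | add x y _ _ hx hy => rw [inner_add_right, hx, hy, add_zero]
    | smul c x _ hx => rw [inner_smul_right, hx, mul_zero]

theorem hermiteProj_hermiteL2 {n : ℕ} {lam : ℝ} (hlam : lam ≠ 0) (k : ℕ) (α : Fin n → ℕ) :
    hermiteProj n lam k (hermiteL2 hlam α) =
      if ∑ i, α i = k then hermiteL2 hlam α else 0 := by
  rw [hermiteProj_apply hlam]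
  simp [inner_hermiteL2, ite_smul]

theorem hermiteProj_hermiteProj {n : ℕ} {lam : ℝ} (hlam : lam ≠ 0) (j k : ℕ) (φ : L2 n) :
    hermiteProj n lam j (hermiteProj n lam k φ) = if k = j then hermiteProj n lam k φ else 0 := by
  rw [hermiteProj_apply hlam k, map_sum]
  simp only [map_smul, hermiteProj_hermiteL2]
  split_ifs with h <;> [skip; rw [← Finset.sum_const_zero
    (s := Finset.piAntidiag (Finset.univ : Finset (Fin n)) k)]] <;>
  · refine Finset.sum_congr rfl fun α hα => ?_
    have hα' : ∑ i, α i = k := by simpa using hα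
    simp [hα', h]

theorem inner_hermiteProj_left {n : ℕ} (lam : ℝ) (k : ℕ) (φ ψ : L2 n) :
    ⟪hermiteProj n lam k φ, ψ⟫_ℂ = ⟪φ, hermiteProj n lam k ψ⟫_ℂ :=
  Submodule.inner_starProjection_left_eq_right _ _ _

/-- The homogeneous components of the reproducing kernel `⟪e_θ, e_η⟫`. -/
theorem inner_coh_hermiteProj_coh {n : ℕ} {lam : ℝ} (hlam : lam ≠ 0) (k : ℕ)
    (θ η : Fin n → ℂ) :
    ⟪coh (abs_pos.2 hlam) θ, hermiteProj n lam k (coh (abs_pos.2 hlam) η)⟫_ℂ =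
      cohNorm n |lam| * ((∑ i, conj (θ i) * η i / (2 * |lam| : ℝ)) ^ k / k.factorial) := by
  have ha := abs_pos.2 hlam
  have hpi := Real.pi_pos
  rw [hermiteProj_apply hlam, inner_sum, Finset.sum_pow_eq_sum_piAntidiag, Finset.sum_div,
    Finset.mul_sum]
  refine Finset.sum_congr rfl fun α hα => ?_
  have hα' : ∑ i, α i = k := by simpa using hα
  have hmult : ((Nat.multinomial Finset.univ α : ℕ) : ℂ) / (k.factorial : ℂ) =
      ∏ i, ((α i).factorial : ℂ)⁻¹ := by
    have h := Nat.multinomial_spec Finset.univ α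
    rw [hα'] at h
    have h2 : (k.factorial : ℂ) ≠ 0 := by exact_mod_cast k.factorial_ne_zero
    have h3 : (∏ i, ((α i).factorial : ℂ)) ≠ 0 :=
      Finset.prod_ne_zero_iff.2 fun i _ => by exact_mod_cast (α i).factorial_ne_zero
    rw [Finset.prod_inv_distrib, div_eq_iff h2, ← h]
    push_cast
    rw [← mul_assoc, inv_mul_cancel₀ h3, one_mul]
  have hn : ((cohNorm n |lam| : ℝ) : ℂ) = ((|lam| ^ ((n : ℝ) / 4) : ℝ) : ℂ) *
      ((|lam| ^ ((n : ℝ) / 4) : ℝ) : ℂ) * ∏ _i : Fin n, ((√Real.pi / |lam| : ℝ) : ℂ) := by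
    rw [← Complex.ofReal_mul, rpow_quarter_sq n ha, Finset.prod_const, Finset.card_univ,
      Fintype.card_fin, ← Complex.ofReal_pow, ← Complex.ofReal_mul, ← mul_pow, cohNorm]
    congr 2
    rw [Real.sqrt_div hpi.le]
    rw [mul_div_assoc', div_eq_div_iff (Real.sqrt_pos.2 ha).ne' ha.ne']
    linear_combination -√Real.pi * Real.mul_self_sqrt ha.le
  rw [inner_smul_right, ← inner_conj_symm (coh (abs_pos.2 hlam) θ), inner_hermiteL2_coh hlam,
    inner_hermiteL2_coh hlam, mul_div_right_comm, hmult, hn, map_mul, map_prod, Complex.conj_ofReal]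
  have key : (∏ i, (((√(((α i).factorial : ℝ) * √Real.pi))⁻¹ * √(Real.pi / |lam|) : ℝ) *
        (η i / √(2 * |lam|)) ^ α i)) *
      (∏ i, conj (((√(((α i).factorial : ℝ) * √Real.pi))⁻¹ * √(Real.pi / |lam|) : ℝ) *
        (θ i / √(2 * |lam|)) ^ α i)) =
      (∏ _i : Fin n, ((√Real.pi / |lam| : ℝ) : ℂ)) * ((∏ i, ((α i).factorial : ℂ)⁻¹) *
        ∏ i, (conj (θ i) * η i / (2 * |lam| : ℝ)) ^ α i) := by
    simp only [← Finset.prod_mul_distrib]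
    refine Finset.prod_congr rfl fun i _ => ?_
    have e1 : (√(((α i).factorial : ℝ) * √Real.pi))⁻¹ * √(Real.pi / |lam|) *
        ((√(((α i).factorial : ℝ) * √Real.pi))⁻¹ * √(Real.pi / |lam|)) =
        √Real.pi / |lam| * ((α i).factorial : ℝ)⁻¹ := by
      rw [mul_mul_mul_comm, ← mul_inv, Real.mul_self_sqrt (by positivity),
        Real.mul_self_sqrt (by positivity)]
      nth_rewrite 2 [← Real.mul_self_sqrt hpi.le]
      field_simp
    have e2 : (η i / (√(2 * |lam|) : ℝ)) * (conj (θ i) / (√(2 * |lam|) : ℝ)) =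
        conj (θ i) * η i / (2 * |lam| : ℝ) := by
      rw [div_mul_div_comm, ← Complex.ofReal_mul, Real.mul_self_sqrt (by positivity),
        mul_comm (η i)]
    rw [map_mul, map_pow, map_div₀, Complex.conj_ofReal, Complex.conj_ofReal, mul_mul_mul_comm,
      ← Complex.ofReal_mul, e1, ← mul_pow, e2]
    push_cast
    ring
  linear_combination ((|lam| ^ ((n : ℝ) / 4) : ℝ) : ℂ) * ((|lam| ^ ((n : ℝ) / 4) : ℝ) : ℂ) * key

/-! ### The Hermite semigroup -/

theorem hasSum_hermiteSemigroup (n : ℕ) {lam t : ℝ} (hlam : lam ≠ 0) (ht : 0 < t) (φ : L2 n) :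
    HasSum (fun k : ℕ => (Real.exp (-t * hermiteEigenvalue n lam k) : ℂ) • hermiteProj n lam k φ)
      (hermiteSemigroup n lam t φ) :=
  (summable_hermiteSemigroup n hlam ht).hasSum.mapL (ContinuousLinearMap.apply ℂ (L2 n) φ)

/-- The semigroup contracts the parameter of a coherent state. -/
theorem hermiteSemigroup_coh {n : ℕ} {lam t : ℝ} (hlam : lam ≠ 0) (ht : 0 < t) (η : Fin n → ℂ) :
    hermiteSemigroup n lam t (coh (abs_pos.2 hlam) η) =
      (Real.exp (-t * n * |lam|) : ℂ) •
        coh (abs_pos.2 hlam) (fun i => (Real.exp (-2 * t * |lam|) : ℂ) * η i) := by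
  rw [← sub_eq_zero]
  refine eq_zero_of_inner_coh (abs_pos.2 hlam) _ fun θ => ?_
  rw [inner_sub_right, sub_eq_zero, inner_smul_right, inner_coh_coh hlam]
  have h := (hasSum_hermiteSemigroup n hlam ht (coh (abs_pos.2 hlam) η)).mapL
    (innerSL ℂ (coh (abs_pos.2 hlam) θ))
  simp only [innerSL_apply_apply, inner_smul_right, inner_coh_hermiteProj_coh hlam] at h
  refine h.unique ?_
  have h2 := (NormedSpace.expSeries_div_hasSum_exp
    (∑ i, conj (θ i) * ((Real.exp (-2 * t * |lam|) : ℂ) * η i) / (2 * |lam| : ℝ))).mul_left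
    ((Real.exp (-t * n * |lam|) : ℂ) * cohNorm n |lam|)
  rw [← Complex.exp_eq_exp_ℂ, mul_assoc (Real.exp (-t * n * |lam|) : ℂ)] at h2
  refine h2.congr_fun fun k => ?_
  have e1 : (∑ i, conj (θ i) * ((Real.exp (-2 * t * |lam|) : ℂ) * η i) / (2 * |lam| : ℝ)) =
      (Real.exp (-2 * t * |lam|) : ℂ) * ∑ i, conj (θ i) * η i / (2 * |lam| : ℝ) := by
    rw [Finset.mul_sum]; exact Finset.sum_congr rfl fun i _ => by ring
  have e2 : (Real.exp (-t * hermiteEigenvalue n lam k) : ℂ) =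
      Real.exp (-t * n * |lam|) * (Real.exp (-2 * t * |lam|) : ℂ) ^ k := by
    rw [← Complex.ofReal_pow, ← Complex.ofReal_mul, ← Real.exp_nat_mul, ← Real.exp_add,
      hermiteEigenvalue]
    congr 2; ring
  rw [e1, e2, mul_pow]
  ring

theorem hermiteSemigroup_inner_left {n : ℕ} {lam t : ℝ} (hlam : lam ≠ 0) (ht : 0 < t)
    (φ ψ : L2 n) :
    ⟪hermiteSemigroup n lam t φ, ψ⟫_ℂ = ⟪φ, hermiteSemigroup n lam t ψ⟫_ℂ := by
  have h1 := (hasSum_hermiteSemigroup n hlam ht ψ).mapL (innerSL ℂ φ)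
  have h2 := (hasSum_hermiteSemigroup n hlam ht φ).mapL (innerSL ℂ ψ)
  have h3 := h2.map (starRingEnd ℂ) Complex.continuous_conj
  simp only [Function.comp_def, innerSL_apply_apply, inner_smul_right, map_mul, inner_conj_symm,
    Complex.conj_ofReal, inner_hermiteProj_left] at h1 h3
  exact h3.unique h1

theorem hermiteSemigroup_eq_zero {n : ℕ} {lam t : ℝ} (hlam : lam ≠ 0) (ht : 0 < t)
    {φ : L2 n} (h : ∀ k, hermiteProj n lam k φ = 0) : hermiteSemigroup n lam t φ = 0 := by
  have := hasSum_hermiteSemigroup n hlam ht φ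
  simp only [h, smul_zero] at this
  exact this.unique hasSum_zero

/-- Completeness of the spectral projections: such a `φ` is annihilated by the self-adjoint operator
`exp (- H(lam))`, whose range contains a multiple of every coherent state. -/
theorem eq_zero_of_hermiteProj_eq_zero {n : ℕ} {lam : ℝ} (hlam : lam ≠ 0) {φ : L2 n}
    (h : ∀ k, hermiteProj n lam k φ = 0) : φ = 0 := by
  refine eq_zero_of_inner_coh (abs_pos.2 hlam) φ fun η => ?_
  have h0 := hermiteSemigroup_eq_zero hlam one_pos h
  have h1 := hermiteSemigroup_inner_left hlam one_pos
    (coh (abs_pos.2 hlam) fun i => (Real.exp (2 * |lam|) : ℂ) * η i) φ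
  rw [h0, inner_zero_right, hermiteSemigroup_coh hlam one_pos, inner_smul_left] at h1
  have e : (fun i => (Real.exp (-2 * 1 * |lam|) : ℂ) * ((Real.exp (2 * |lam|) : ℂ) * η i)) = η := by
    ext i
    rw [← mul_assoc, ← Complex.ofReal_mul, ← Real.exp_add]
    have : -2 * 1 * |lam| + 2 * |lam| = 0 := by ring
    rw [this, Real.exp_zero, Complex.ofReal_one, one_mul]
  rw [e] at h1
  refine (mul_eq_zero.1 h1).resolve_left ?_
  rw [Complex.conj_ofReal]
  exact_mod_cast (Real.exp_pos _).ne'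

theorem dense_span_of_inner {n : ℕ} {ι : Type*} (v : ι → L2 n)
    (h : ∀ φ, (∀ i, ⟪v i, φ⟫_ℂ = 0) → φ = 0) :
    Dense (Submodule.span ℂ (Set.range v) : Set (L2 n)) := by
  rw [Submodule.dense_iff_topologicalClosure_eq_top, Submodule.topologicalClosure_eq_top_iff,
    Submodule.eq_bot_iff]
  exact fun φ hφ => h φ fun i => hφ _ (Submodule.subset_span ⟨i, rfl⟩)

theorem dense_span_coh {n : ℕ} {a : ℝ} (ha : 0 < a) :
    Dense (Submodule.span ℂ (Set.range (coh ha : (Fin n → ℂ) → L2 n)) : Set (L2 n)) :=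
  dense_span_of_inner _ (eq_zero_of_inner_coh ha)

theorem dense_span_hermiteL2 {n : ℕ} {lam : ℝ} (hlam : lam ≠ 0) :
    Dense (Submodule.span ℂ (Set.range (hermiteL2 (n := n) hlam)) : Set (L2 n)) :=
  dense_span_of_inner _ fun φ h => eq_zero_of_hermiteProj_eq_zero hlam fun k => by
    simp [hermiteProj_apply hlam, h]

theorem hermiteSemigroup_apply_of_proj {n : ℕ} {lam t : ℝ} (hlam : lam ≠ 0) (ht : 0 < t) {k : ℕ}
    {φ : L2 n} (h : hermiteProj n lam k φ = φ) :
    hermiteSemigroup n lam t φ = (Real.exp (-t * hermiteEigenvalue n lam k) : ℂ) • φ := by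
  refine (hasSum_hermiteSemigroup n hlam ht φ).unique ?_
  have e : ∀ j, j ≠ k →
      (Real.exp (-t * hermiteEigenvalue n lam j) : ℂ) • hermiteProj n lam j φ = 0 := by
    intro j hj
    rw [← h, hermiteProj_hermiteProj hlam, if_neg hj.symm, smul_zero]
  convert hasSum_single k e using 2
  exact h.symm

theorem hermiteSemigroup_comp {n : ℕ} {lam s t : ℝ} (hlam : lam ≠ 0) (hs : 0 < s) (ht : 0 < t) :
    hermiteSemigroup n lam s ∘L hermiteSemigroup n lam t = hermiteSemigroup n lam (s + t) := by
  refine ContinuousLinearMap.ext_on (dense_span_hermiteL2 hlam) ?_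
  rintro _ ⟨α, rfl⟩
  have h : hermiteProj n lam (∑ i, α i) (hermiteL2 hlam α) = hermiteL2 hlam α := by
    rw [hermiteProj_hermiteL2, if_pos rfl]
  rw [ContinuousLinearMap.comp_apply, hermiteSemigroup_apply_of_proj hlam ht h, map_smul,
    hermiteSemigroup_apply_of_proj hlam hs h,
    hermiteSemigroup_apply_of_proj hlam (add_pos hs ht) h, smul_smul, ← Complex.ofReal_mul,
    ← Real.exp_add]
  congr 3; ring

/-! ### Operators commuting with `H(lam)` -/

/-- `P_j H(lam) φ = (2 j + n) |lam| P_j φ` on the domain of `H(lam)`. -/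
theorem hermiteProj_hermiteOp {n : ℕ} {lam : ℝ} (hlam : lam ≠ 0) (j : ℕ)
    (φ : (hermiteOp n lam).domain) :
    hermiteProj n lam j (hermiteOp n lam φ) =
      (hermiteEigenvalue n lam j : ℂ) • hermiteProj n lam j φ := by
  have hs :
      Summable fun k : ℕ => (hermiteEigenvalue n lam k : ℂ) • hermiteProj n lam k (φ : L2 n) :=
    φ.2
  have h := hs.hasSum.mapL (hermiteProj n lam j)
  refine h.unique ?_
  simp only [map_smul, hermiteProj_hermiteProj hlam]
  convert hasSum_single j fun k hk => ?_ using 1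
  · simp
  · simp [hk]

/-- A bounded operator commuting with `H(lam)` preserves its eigenspaces, because the eigenvalues
are pairwise distinct and the spectral projections are complete. -/
theorem CommutesWith.hermiteProj_apply_eq {n : ℕ} {lam : ℝ} (hlam : lam ≠ 0)
    {M : L2 n →L[ℂ] L2 n} (hM : CommutesWith M (hermiteOp n lam)) {k : ℕ} {φ : L2 n}
    (h : hermiteProj n lam k φ = φ) : hermiteProj n lam k (M φ) = M φ := by
  have hz : ∀ j, j ≠ k → hermiteProj n lam j φ = 0 := fun j hj => by
    rw [← h, hermiteProj_hermiteProj hlam, if_neg hj.symm]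
  have hsum : HasSum (fun j : ℕ => (hermiteEigenvalue n lam j : ℂ) • hermiteProj n lam j φ)
      ((hermiteEigenvalue n lam k : ℂ) • φ) := by
    convert hasSum_single k fun j hj => ?_ using 2
    · exact h.symm
    · rw [hz j hj, smul_zero]
  have hdom : φ ∈ (hermiteOp n lam).domain := hsum.summable
  have hop : hermiteOp n lam ⟨φ, hdom⟩ = (hermiteEigenvalue n lam k : ℂ) • φ := hsum.tsum_eq
  obtain ⟨hd, hc⟩ := hM ⟨φ, hdom⟩
  have hj : ∀ j, j ≠ k → hermiteProj n lam j (M φ) = 0 := by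
    intro j hj
    have h1 := hermiteProj_hermiteOp hlam j ⟨M φ, hd⟩
    rw [hc, hop, map_smul, map_smul, ← sub_eq_zero, ← sub_smul] at h1
    refine (smul_eq_zero.1 h1).resolve_left ?_
    refine sub_ne_zero.2 fun h2 => ?_
    have ha := (abs_pos.2 hlam).ne'
    simp only [hermiteEigenvalue] at h2
    norm_cast at h2
    have h3 := mul_right_cancel₀ ha h2
    norm_cast at h3
    omega
  rw [← sub_eq_zero]
  refine eq_zero_of_hermiteProj_eq_zero hlam fun j => ?_
  rw [map_sub, hermiteProj_hermiteProj hlam]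
  split_ifs with hjk
  · rw [hjk, sub_self]
  · rw [hj j fun h => hjk h.symm, sub_zero]

theorem CommutesWith.comp_hermiteSemigroup {n : ℕ} {lam t : ℝ} (hlam : lam ≠ 0) (ht : 0 < t)
    {M : L2 n →L[ℂ] L2 n} (hM : CommutesWith M (hermiteOp n lam)) :
    hermiteSemigroup n lam t ∘L M = M ∘L hermiteSemigroup n lam t := by
  refine ContinuousLinearMap.ext_on (dense_span_hermiteL2 hlam) ?_
  rintro _ ⟨α, rfl⟩
  have h : hermiteProj n lam (∑ i, α i) (hermiteL2 hlam α) = hermiteL2 hlam α := by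
    rw [hermiteProj_hermiteL2, if_pos rfl]
  rw [ContinuousLinearMap.comp_apply, ContinuousLinearMap.comp_apply,
    hermiteSemigroup_apply_of_proj hlam ht h,
    hermiteSemigroup_apply_of_proj hlam ht (hM.hermiteProj_apply_eq hlam h), map_smul]


/-! ### Fourier duality and the Gaussian form of the twisted convolution -/

theorem memLp_phase_gaussian {n : ℕ} {b : ℝ} (hb : 0 < b) (c d e : Fin n → ℂ) :
    MemLp (fun v : Phase n => Complex.exp (∑ i,
      (-b * ((v (.inl i) : ℂ) ^ 2 + (v (.inr i) : ℂ) ^ 2) +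
        c i * v (.inl i) + d i * v (.inr i) + e i))) 2 := by
  rw [memLp_two_iff_integrable_sq_norm (by fun_prop)]
  refine (integrable_phase_gaussian (show 0 < 2 * b by positivity) (fun i => 2 * c i)
    (fun i => 2 * d i) (fun i => 2 * e i)).norm.congr (Filter.Eventually.of_forall fun v => ?_)
  simp only [← norm_pow, ← Complex.exp_nat_mul, Finset.mul_sum]
  congr 2; refine Finset.sum_congr rfl fun i _ => ?_
  push_cast; ring

theorem integral_mul_eq_inner {n : ℕ} {G : Phase n → ℂ} (hG : MemLp (fun y => conj (G y)) 2)
    (φ : L2Phase n) : ∫ y, φ y * G y = ⟪hG.toLp _, φ⟫_ℂ := by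
  rw [L2.inner_def]
  refine integral_congr_ae ?_
  filter_upwards [hG.coeFn_toLp] with y hy
  rw [hy, RCLike.inner_apply, Complex.conj_conj]

/-- The identity `∫ (𝓕 f) Γ = ∫ f (𝓕 Γ)` for `f ∈ L²`, by density from that for Schwartz
functions. -/
theorem integral_fourier_mul_of_memLp {n : ℕ} (f : L2Phase n) {Γ : Phase n → ℂ}
    (h1 : Integrable Γ) (h2 : MemLp Γ 2) (h3 : MemLp (𝓕 Γ) 2) :
    ∫ y, (𝓕 f : L2Phase n) y * Γ y = ∫ v, f v * 𝓕 Γ v := by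
  have hA : MemLp (fun y => conj (Γ y)) 2 := h2.star
  have hB : MemLp (fun y => conj (𝓕 Γ y)) 2 := h3.star
  have hS : ∀ G : SchwartzMap (Phase n) ℂ, ⟪hA.toLp _, 𝓕 (G.toLp 2)⟫_ℂ =
      ⟪hB.toLp _, G.toLp 2⟫_ℂ := by
    intro G
    rw [SchwartzMap.toLp_fourier_eq, ← integral_mul_eq_inner, ← integral_mul_eq_inner]
    have key := integral_fourier_mul_of_integrable (G.integrable (μ := volume)) h1
    rw [← SchwartzMap.fourier_coe] at key
    refine Eq.trans (integral_congr_ae ?_) (key.trans (integral_congr_ae ?_))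
    · filter_upwards [(𝓕 G : SchwartzMap (Phase n) ℂ).coeFn_toLp 2] with y hy
      rw [hy]
    · filter_upwards [G.coeFn_toLp 2] with y hy
      rw [hy]
  have hF : Continuous fun f : L2Phase n => (𝓕 f : L2Phase n) :=
    (Lp.fourierTransformₗᵢ (Phase n) ℂ).continuous
  have hcl : IsClosed {φ : L2Phase n | ⟪hA.toLp _, (𝓕 φ : L2Phase n)⟫_ℂ = ⟪hB.toLp _, φ⟫_ℂ} :=
    isClosed_eq (continuous_const.inner hF) (continuous_const.inner continuous_id)
  rw [integral_mul_eq_inner hA, integral_mul_eq_inner hB]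
  have hd : DenseRange (SchwartzMap.toLpCLM ℝ ℂ 2 (volume : Measure (Phase n))) :=
    SchwartzMap.denseRange_toLpCLM ENNReal.ofNat_ne_top
  exact hd.induction_on (p := fun φ : L2Phase n =>
    ⟪hA.toLp _, (𝓕 φ : L2Phase n)⟫_ℂ = ⟪hB.toLp _, φ⟫_ℂ) f hcl hS

/-- `lam coth (lam t)` is even in `lam`. -/
theorem mul_coth_eq {lam t : ℝ} (hlam : lam ≠ 0) (ht : 0 < t) :
    lam * (Real.cosh (lam * t) / Real.sinh (lam * t)) =
      |lam| * ((1 + Real.exp (-2 * t * |lam|)) / (1 - Real.exp (-2 * t * |lam|))) := by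
  have h : lam * (Real.cosh (lam * t) / Real.sinh (lam * t)) =
      |lam| * (Real.cosh (|lam| * t) / Real.sinh (|lam| * t)) := by
    rcases abs_cases lam with ⟨h, _⟩ | ⟨h, _⟩ <;> rw [h]
    rw [neg_mul lam t, Real.cosh_neg, Real.sinh_neg, div_neg]; ring
  have e : Real.exp (-2 * t * |lam|) = (Real.exp (|lam| * t))⁻¹ * (Real.exp (|lam| * t))⁻¹ := by
    rw [← Real.exp_neg, ← Real.exp_add]; congr 1; ring
  have h1 : 1 < Real.exp (|lam| * t) := Real.one_lt_exp_iff.2 (by positivity)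
  have h2 : Real.exp (|lam| * t) ^ 2 - 1 ≠ 0 := by nlinarith
  rw [h, Real.cosh_eq, Real.sinh_eq, e, Real.exp_neg]
  congr 1
  have h3 : Real.exp (|lam| * t) - (Real.exp (|lam| * t))⁻¹ ≠ 0 := by
    have : (Real.exp (|lam| * t))⁻¹ < 1 := inv_lt_one_of_one_lt₀ h1
    linarith
  have h4 : 1 - (Real.exp (|lam| * t))⁻¹ * (Real.exp (|lam| * t))⁻¹ ≠ 0 := by
    intro h5
    apply h2
    field_simp at h5
    linarith
  rw [div_div_div_cancel_right₀ two_ne_zero, div_eq_div_iff h3 h4]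
  field_simp

theorem cConst_half_eq {lam : ℝ} (hlam : lam ≠ 0) : cConst lam (1 / 2) =
    |lam| / 2 * ((1 + Real.exp (-|lam|)) / (1 - Real.exp (-|lam|))) := by
  have h := mul_coth_eq hlam one_half_pos
  have e : -2 * (1 / 2) * |lam| = -|lam| := by ring
  rw [e, mul_comm lam (1 / 2)] at h
  rw [cConst]
  linear_combination h / 2

theorem exp_neg_abs_lt_one {lam : ℝ} (hlam : lam ≠ 0) : Real.exp (-|lam|) < 1 :=
  Real.exp_lt_one_iff.2 (neg_neg_of_pos (abs_pos.2 hlam))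

theorem cConst_half_pos {lam : ℝ} (hlam : lam ≠ 0) : 0 < cConst lam (1 / 2) := by
  rw [cConst_half_eq hlam]
  have h1 := exp_neg_abs_lt_one hlam
  positivity

/-- The Gaussian `exp (- c |v|² / 2 - (lam / 2) Im (z ⬝ conj v) - i c z ⬝ v)`, where
`c = (lam / 2) coth (lam / 2)`. -/
def tiltedGaussian {n : ℕ} (lam : ℝ) (z v : Phase n) : ℂ :=
  Complex.exp (∑ i, (-(cConst lam (1 / 2) / 2 : ℝ) *
      ((v (.inl i) : ℂ) ^ 2 + (v (.inr i) : ℂ) ^ 2)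
    + (-(lam / 2) * z (.inr i) - Complex.I * cConst lam (1 / 2) * z (.inl i)) * v (.inl i)
    + ((lam / 2) * z (.inl i) - Complex.I * cConst lam (1 / 2) * z (.inr i)) * v (.inr i) + 0))

/-- The constant in front of the Gaussian in `p_t^lam`. -/
def heatConst (n : ℕ) (lam t : ℝ) : ℝ := ((4 * Real.pi) ^ n)⁻¹ * (lam / Real.sinh (lam * t)) ^ n

theorem heatKernel_half_eq {n : ℕ} (lam : ℝ) (v : Phase n) :
    (heatKernel lam (1 / 2) v : ℂ) = heatConst n lam (1 / 2) *
      Complex.exp (∑ i, -(cConst lam (1 / 2) / 2 : ℝ) *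
        ((v (.inl i) : ℂ) ^ 2 + (v (.inr i) : ℂ) ^ 2)) := by
  have e : (∑ i, -(cConst lam (1 / 2) / 2 : ℝ) * ((v (.inl i) : ℂ) ^ 2 + (v (.inr i) : ℂ) ^ 2)) =
      ((-(1 / 4) * lam * (Real.cosh (lam * (1 / 2)) / Real.sinh (lam * (1 / 2))) * ‖v‖ ^ 2 : ℝ)
        : ℂ) := by
    rw [phase_norm_sq, cConst, mul_comm (1 / 2 : ℝ) lam, ← Finset.mul_sum]
    push_cast
    ring
  rw [e, heatKernel, heatConst]
  push_cast
  ring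

/-- `U_lam f ∗ p_{1/2}`, rewritten by Fourier duality as an integral of `f` itself against a
Gaussian. -/
theorem twistedConv_U_heatKernel {n : ℕ} {lam : ℝ} (hlam : lam ≠ 0) :
    ∃ K : ℂ, ∀ (f : L2Phase n) (z : Phase n),
      twistedConv lam (U lam f) (fun v => (heatKernel lam (1 / 2) v : ℂ)) z =
        K * Real.exp (-(lam ^ 2 / (8 * cConst lam (1 / 2))) * ‖z‖ ^ 2) *
          ∫ v, f v * tiltedGaussian lam z v := by
  have hc := cConst_half_pos hlam
  set c := cConst lam (1 / 2) with hcdef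
  have hpi := Real.pi_pos
  have hc0 : (c : ℂ) ≠ 0 := by exact_mod_cast hc.ne'
  -- `U_lam f` is a multiple of `𝓕 f (R • ·)`; in the variable `y = R • w`, the Gaussian
  -- `p_{1/2}(z - w)` decays like `exp (- b |y|²)`.
  set R : ℝ := (2 * Real.pi)⁻¹ * c with hR
  set b : ℝ := 2 * Real.pi ^ 2 / c with hb
  have hbpos : 0 < b := by positivity
  refine ⟨((c ^ n : ℝ) : ℂ) * ((((2 * Real.pi) ^ n)⁻¹ : ℝ) : ℂ) *
    (|(R ^ Module.finrank ℝ (Phase n))⁻¹| : ℝ) * (heatConst n lam (1 / 2) : ℂ) *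
    (((Real.pi / b) ^ n : ℝ) : ℂ), fun f z => ?_⟩
  set γ : Phase n → ℂ := fun y => Complex.exp (∑ i,
      (-b * ((y (.inl i) : ℂ) ^ 2 + (y (.inr i) : ℂ) ^ 2) +
        (2 * Real.pi * z (.inl i) - Complex.I * Real.pi * lam / c * z (.inr i)) * y (.inl i) +
        (2 * Real.pi * z (.inr i) + Complex.I * Real.pi * lam / c * z (.inl i)) * y (.inr i) +
        -(c / 2) * ((z (.inl i) : ℂ) ^ 2 + (z (.inr i) : ℂ) ^ 2))) with hγ
  have hγF : ∀ v, 𝓕 γ v = (((Real.pi / b) ^ n : ℝ) : ℂ) *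
      (Real.exp (-(lam ^ 2 / (8 * c)) * ‖z‖ ^ 2) * tiltedGaussian lam z v) := by
    intro v
    have h := integral_phase_gaussian hbpos
      (fun i => 2 * Real.pi * z (.inl i) - Complex.I * Real.pi * lam / c * z (.inr i)
        - 2 * Real.pi * Complex.I * v (.inl i))
      (fun i => 2 * Real.pi * z (.inr i) + Complex.I * Real.pi * lam / c * z (.inl i)
        - 2 * Real.pi * Complex.I * v (.inr i))
      (fun i => -(c / 2) * ((z (.inl i) : ℂ) ^ 2 + (z (.inr i) : ℂ) ^ 2))
    rw [Real.fourier_eq']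
    refine Eq.trans ?_ (h.trans ?_)
    · congr 1; ext y
      rw [hγ, smul_eq_mul, ← Complex.exp_add, PiLp.inner_apply, Fintype.sum_sum_type]
      congr 1
      push_cast
      rw [← Finset.sum_add_distrib, Finset.mul_sum, Finset.sum_mul, ← Finset.sum_add_distrib]
      refine Finset.sum_congr rfl fun i _ => ?_
      simp only [RCLike.inner_apply, RCLike.conj_to_real]
      push_cast
      ring
    · congr 1
      rw [tiltedGaussian, phase_norm_sq, Complex.ofReal_exp, ← Complex.exp_add]
      push_cast
      rw [Finset.mul_sum, ← Finset.sum_add_distrib]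
      congr 1
      refine Finset.sum_congr rfl fun i _ => ?_
      rw [← hcdef, hb]
      push_cast
      field_simp
      ring_nf
      simp only [Complex.I_sq]
      ring
  have hγF' : 𝓕 γ = fun v => (((Real.pi / b) ^ n : ℝ) : ℂ) *
      (Real.exp (-(lam ^ 2 / (8 * c)) * ‖z‖ ^ 2) * tiltedGaussian lam z v) := funext hγF
  have hdual := integral_fourier_mul_of_memLp f (Γ := γ)
    (integrable_phase_gaussian hbpos _ _ _) (memLp_phase_gaussian hbpos _ _ _)
    (by
      rw [hγF']
      exact ((memLp_phase_gaussian (show 0 < c / 2 by positivity) _ _ _).const_mul _).const_mul _)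
  have hscale := Measure.integral_comp_smul (volume : Measure (Phase n))
    (fun y => (𝓕 f : L2Phase n) y * γ y) R
  rw [hdual] at hscale
  simp only [hγF] at hscale
  have hint : ∀ w : Phase n, U lam f w * (heatKernel lam (1 / 2) (z - w) : ℂ) *
      Complex.exp (Complex.I * (lam / 2 * imForm z (z - w) : ℝ)) =
      ((c ^ n : ℝ) : ℂ) * ((((2 * Real.pi) ^ n)⁻¹ : ℝ) : ℂ) * (heatConst n lam (1 / 2) : ℂ) *
        ((𝓕 f : L2Phase n) (R • w) * γ (R • w)) := by
    intro w
    have hg : Complex.exp (∑ i, -(c / 2 : ℝ) * (((z - w) (.inl i) : ℂ) ^ 2 +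
          ((z - w) (.inr i) : ℂ) ^ 2)) *
        Complex.exp (Complex.I * (lam / 2 * imForm z (z - w) : ℝ)) = γ (R • w) := by
      rw [hγ, ← Complex.exp_add, imForm_eq_sum]
      push_cast
      rw [Finset.mul_sum, Finset.mul_sum, ← Finset.sum_add_distrib]
      congr 1
      refine Finset.sum_congr rfl fun i _ => ?_
      simp only [PiLp.sub_apply, PiLp.smul_apply, smul_eq_mul, hR, hb]
      push_cast
      field_simp
      ring
    rw [← hg, heatKernel_half_eq, U, intertwiner, euclideanFourier, ← hcdef, smul_smul, ← hR]
    ring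
  rw [twistedConv, ← integral_sub_left_eq_self _ volume z]
  simp only [sub_sub_cancel, hint]
  rw [integral_const_mul, hscale, Complex.real_smul]
  have hmove : ∫ v, f v * ((((Real.pi / b) ^ n : ℝ) : ℂ) *
      (Real.exp (-(lam ^ 2 / (8 * c)) * ‖z‖ ^ 2) * tiltedGaussian lam z v)) =
      (((Real.pi / b) ^ n : ℝ) : ℂ) * Real.exp (-(lam ^ 2 / (8 * c)) * ‖z‖ ^ 2) *
        ∫ v, f v * tiltedGaussian lam z v := by
    rw [← integral_const_mul]
    congr 1; ext v; ring
  rw [hmove]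
  ring


/-! ### Superpositions of coherent states and the pointwise bound -/

theorem integrable_phase_gaussian_real {n : ℕ} {b : ℝ} (hb : 0 < b) (c d e : Fin n → ℝ) :
    Integrable fun v : Phase n => Real.exp (∑ i,
      (-b * (v (.inl i) ^ 2 + v (.inr i) ^ 2) + c i * v (.inl i) + d i * v (.inr i) + e i)) := by
  refine (integrable_phase_gaussian hb (fun i => c i) (fun i => d i) (fun i => e i)).norm.congr
    (Filter.Eventually.of_forall fun v => ?_)
  simp only [Complex.norm_exp]
  norm_cast

theorem integral_phase_gaussian_real {n : ℕ} {b : ℝ} (hb : 0 < b) (c d e : Fin n → ℝ) :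
    ∫ v : Phase n, Real.exp (∑ i,
      (-b * (v (.inl i) ^ 2 + v (.inr i) ^ 2) + c i * v (.inl i) + d i * v (.inr i) + e i)) =
      (Real.pi / b) ^ n * Real.exp (∑ i, ((c i ^ 2 + d i ^ 2) / (4 * b) + e i)) := by
  have h := integral_phase_gaussian hb (fun i => (c i : ℂ)) (fun i => d i) (fun i => e i)
  have e1 : ∀ v : Phase n, Complex.exp (∑ i, (-b * ((v (.inl i) : ℂ) ^ 2 + (v (.inr i) : ℂ) ^ 2) +
        c i * v (.inl i) + d i * v (.inr i) + e i)) = ((Real.exp (∑ i,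
      (-b * (v (.inl i) ^ 2 + v (.inr i) ^ 2) + c i * v (.inl i) + d i * v (.inr i) + e i)) : ℝ)
        : ℂ) := by
    intro v; push_cast; rfl
  simp only [e1] at h
  rw [integral_complex_ofReal] at h
  exact_mod_cast h

/-- The map `τ(x, u) = - |lam| u + i lam x` from phase space to `ℂⁿ`: `π_lam(v)` moves the coherent
state `e_η` to a multiple of `e_{η + τ(v)}`. -/
def tau {n : ℕ} (lam : ℝ) (v : Phase n) (i : Fin n) : ℂ :=
  -|lam| * v (.inr i) + Complex.I * lam * v (.inl i)

/-- The positive weight `exp (- |lam| |w|² / 2 - lam Im (z ⬝ conj w))`, with respect to which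
`π_lam(i z)` is, formally and up to a scalar, a superposition of the rank one operators
`|e_η⟩⟨e_η|`, `η = τ(w)`. -/
def cohWeight {n : ℕ} (lam : ℝ) (z w : Phase n) : ℝ :=
  Real.exp (∑ i, (-(|lam| / 2) * (w (.inl i) ^ 2 + w (.inr i) ^ 2)
    + -(lam * z (.inr i)) * w (.inl i) + lam * z (.inl i) * w (.inr i) + 0))

/-- The parameter `q τ(w)`, where `q = exp (- |lam|)`: that of the coherent state onto which
`exp (- H(lam) / 2)` maps `e_{τ(w)}`, up to a scalar. -/
def contractedTau {n : ℕ} (lam : ℝ) (w : Phase n) (i : Fin n) : ℂ :=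
  (Real.exp (-|lam|) : ℂ) * tau lam w i

theorem norm_sq_tau {n : ℕ} (lam : ℝ) (w : Phase n) (i : Fin n) :
    ‖tau lam w i‖ ^ 2 = |lam| ^ 2 * (w (.inl i) ^ 2 + w (.inr i) ^ 2) := by
  have e : tau lam w i = ((-|lam| * w (.inr i) : ℝ) : ℂ) + ((lam * w (.inl i) : ℝ) : ℂ) *
      Complex.I := by
    rw [tau]; push_cast; ring
  rw [e, Complex.sq_norm, Complex.normSq_add_mul_I, mul_pow, mul_pow, neg_sq, sq_abs]
  ring

theorem hermiteSemigroup_half_coh_tau {n : ℕ} {lam : ℝ} (hlam : lam ≠ 0) (w : Phase n) :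
    hermiteSemigroup n lam (1 / 2) (coh (abs_pos.2 hlam) (tau lam w)) =
      (Real.exp (-(1 / 2) * n * |lam|) : ℂ) • coh (abs_pos.2 hlam) (contractedTau lam w) := by
  rw [hermiteSemigroup_coh hlam one_half_pos]
  have e : -2 * (1 / 2) * |lam| = -|lam| := by ring
  rw [e]
  rfl

theorem weighted_matrixCoeff_eq {n : ℕ} {lam : ℝ} (hlam : lam ≠ 0) (z v w : Phase n) :
    (cohWeight lam z w : ℂ) * ⟪coh (abs_pos.2 hlam) (tau lam w),
        schrodinger lam v (coh (abs_pos.2 hlam) (contractedTau lam w))⟫_ℂ =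
      cohNorm n |lam| * Complex.exp (∑ i,
        (-((1 - Real.exp (-|lam|)) * |lam| / 2 : ℝ) *
            ((w (.inl i) : ℂ) ^ 2 + (w (.inr i) : ℂ) ^ 2)
          + (-lam * z (.inr i) + ((1 - Real.exp (-|lam|)) * |lam| * v (.inl i) +
              Complex.I * (1 + Real.exp (-|lam|)) * lam * v (.inr i)) / 2) * w (.inl i)
          + (lam * z (.inl i) + ((1 - Real.exp (-|lam|)) * |lam| * v (.inr i) -
              Complex.I * (1 + Real.exp (-|lam|)) * lam * v (.inl i)) / 2) * w (.inr i)
          + -(|lam| / 4) * ((v (.inl i) : ℂ) ^ 2 + (v (.inr i) : ℂ) ^ 2))) := by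
  have ha := abs_pos.2 hlam
  have ha0 : ((|lam| : ℝ) : ℂ) ≠ 0 := by exact_mod_cast ha.ne'
  have hsq : (lam : ℂ) ^ 2 = ((|lam| : ℝ) : ℂ) ^ 2 := by norm_cast; exact (sq_abs lam).symm
  rw [inner_coh_schrodinger hlam, cohWeight, mul_left_comm, Complex.ofReal_exp, ← Complex.exp_add]
  push_cast
  rw [← Finset.sum_add_distrib]
  congr 2
  refine Finset.sum_congr rfl fun i _ => ?_
  simp only [contractedTau, tau, map_add, map_mul, map_neg, Complex.conj_ofReal, Complex.conj_I]
  push_cast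
  field_simp
  ring_nf
  simp only [Complex.I_sq, hsq]
  ring

/-- The Gaussian `v ↦ tiltedGaussian lam z v` is a superposition, with positive weights, of the
matrix coefficients `⟪e_η, π_lam(v) e_{q η}⟫`. -/
theorem integral_weighted_matrixCoeff {n : ℕ} {lam : ℝ} (hlam : lam ≠ 0) (z v : Phase n) :
    ∫ w, (cohWeight lam z w : ℂ) * ⟪coh (abs_pos.2 hlam) (tau lam w),
        schrodinger lam v (coh (abs_pos.2 hlam) (contractedTau lam w))⟫_ℂ =
      (cohNorm n |lam| * (Real.pi / ((1 - Real.exp (-|lam|)) * |lam| / 2)) ^ n *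
        Real.exp (|lam| / (2 * (1 - Real.exp (-|lam|))) * ‖z‖ ^ 2) : ℝ) *
        tiltedGaussian lam z v := by
  have ha := abs_pos.2 hlam
  have hq := exp_neg_abs_lt_one hlam
  have ha0 : ((|lam| : ℝ) : ℂ) ≠ 0 := by exact_mod_cast ha.ne'
  have hsq : (lam : ℂ) ^ 2 = ((|lam| : ℝ) : ℂ) ^ 2 := by norm_cast; exact (sq_abs lam).symm
  simp only [weighted_matrixCoeff_eq hlam]
  rw [tiltedGaussian, cConst_half_eq hlam, integral_const_mul]
  generalize Real.exp (-|lam|) = q at *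
  have hb : 0 < (1 - q) * |lam| / 2 := by have : 0 < 1 - q := by linarith
                                          positivity
  have hq0 : (1 - q : ℂ) ≠ 0 := by norm_cast; exact (by linarith : 0 < 1 - q).ne'
  rw [integral_phase_gaussian hb, phase_norm_sq]
  push_cast
  rw [Finset.mul_sum, mul_assoc, mul_assoc, mul_assoc, ← Complex.exp_add, ← Finset.sum_add_distrib]
  congr 3
  refine Finset.sum_congr rfl fun i _ => ?_
  field_simp
  ring_nf
  simp only [Complex.I_sq, hsq]
  ring

/-- A majorant in which the variables `v` and `w` are separated, for Fubini's theorem. -/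
theorem norm_weighted_matrixCoeff_le {n : ℕ} {lam : ℝ} (hlam : lam ≠ 0) (z v w : Phase n) :
    ‖(cohWeight lam z w : ℂ) * ⟪coh (abs_pos.2 hlam) (tau lam w),
        schrodinger lam v (coh (abs_pos.2 hlam) (contractedTau lam w))⟫_ℂ‖ ≤
      Real.exp (∑ i, (-(Real.exp (-|lam|) * |lam| / 4) * (v (.inl i) ^ 2 + v (.inr i) ^ 2))) *
      (cohNorm n |lam| * Real.exp (∑ i,
        (-((1 - Real.exp (-|lam|)) * |lam| / 4) * (w (.inl i) ^ 2 + w (.inr i) ^ 2)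
          + -(lam * z (.inr i)) * w (.inl i) + lam * z (.inl i) * w (.inr i) + 0))) := by
  have hq := exp_neg_abs_lt_one hlam
  rw [weighted_matrixCoeff_eq hlam, norm_mul, Complex.norm_real, Real.norm_eq_abs,
    abs_of_pos (cohNorm_pos n (abs_pos.2 hlam)), mul_left_comm]
  refine mul_le_mul_of_nonneg_left ?_ (cohNorm_pos n (abs_pos.2 hlam)).le
  generalize Real.exp (-|lam|) = q at *
  rw [Complex.norm_exp, ← Real.exp_add, ← Finset.sum_add_distrib, Complex.re_sum]
  refine Real.exp_le_exp.2 (Finset.sum_le_sum fun i _ => ?_)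
  have e : (-((1 - q) * |lam| / 2 : ℝ) * ((w (.inl i) : ℂ) ^ 2 + (w (.inr i) : ℂ) ^ 2)
          + (-lam * z (.inr i) + ((1 - q) * |lam| * v (.inl i) +
              Complex.I * (1 + q) * lam * v (.inr i)) / 2) * w (.inl i)
          + (lam * z (.inl i) + ((1 - q) * |lam| * v (.inr i) -
              Complex.I * (1 + q) * lam * v (.inl i)) / 2) * w (.inr i)
          + -(|lam| / 4) * ((v (.inl i) : ℂ) ^ 2 + (v (.inr i) : ℂ) ^ 2)) =
      ((-((1 - q) * |lam| / 2) * (w (.inl i) ^ 2 + w (.inr i) ^ 2)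
        + (-lam * z (.inr i) + (1 - q) * |lam| * v (.inl i) / 2) * w (.inl i)
        + (lam * z (.inl i) + (1 - q) * |lam| * v (.inr i) / 2) * w (.inr i)
        + -(|lam| / 4) * (v (.inl i) ^ 2 + v (.inr i) ^ 2) : ℝ) : ℂ) +
      (((1 + q) * lam * v (.inr i) / 2 * w (.inl i) - (1 + q) * lam * v (.inl i) / 2 * w (.inr i)
        : ℝ) : ℂ) * Complex.I := by
    push_cast; ring
  rw [e, Complex.add_re, Complex.re_ofReal_mul, Complex.I_re, mul_zero, add_zero,
    Complex.ofReal_re]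
  have h1 : 0 ≤ (1 - q) * |lam| := mul_nonneg (by linarith) (abs_nonneg _)
  -- The cross term is at most `(1 - q) |lam| (|v|² + |w|²) / 4`.
  nlinarith [mul_nonneg h1 (sq_nonneg (v (.inl i) - w (.inl i))),
    mul_nonneg h1 (sq_nonneg (v (.inr i) - w (.inr i)))]

theorem integrable_mul_gaussian {n : ℕ} {f : Phase n → ℂ} (hf : MemLp f 2) {b : ℝ} (hb : 0 < b) :
    Integrable fun v => ‖f v‖ *
      Real.exp (∑ i, (-b * (v (.inl i) ^ 2 + v (.inr i) ^ 2))) := by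
  have h := (hf.integrable_mul (memLp_phase_gaussian hb 0 0 0)).norm
  refine h.congr (Filter.Eventually.of_forall fun v => ?_)
  simp only [Pi.mul_apply, norm_mul, Complex.norm_exp, Pi.zero_apply, zero_mul, add_zero]
  norm_cast

/-- The key estimate: `∫ f G_z` is a positive superposition of the numbers `⟪e_{q η}, M e_{q η}⟫`,
because one factor `exp (- H(lam) / 2)` comes from the Weyl transform of `f` and another one from
the Gaussian `G_z`. -/
theorem norm_integral_mul_tiltedGaussian_le {n : ℕ} {lam : ℝ} (hlam : lam ≠ 0) (f : L2Phase n)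
    (M : L2 n →L[ℂ] L2 n)
    (hM : IsWeylTransform lam f (hermiteSemigroup n lam (1 / 2) ∘L M)) :
    ∃ C : ℝ, 0 ≤ C ∧ ∀ z, ‖∫ v, f v * tiltedGaussian lam z v‖ ≤
      C * Real.exp ((|lam| / (2 * (1 - Real.exp (-|lam|) ^ 2)) -
        |lam| / (2 * (1 - Real.exp (-|lam|)))) * ‖z‖ ^ 2) := by
  have ha := abs_pos.2 hlam
  have hq := exp_neg_abs_lt_one hlam
  have hq0 := Real.exp_pos (-|lam|)
  have hN := cohNorm_pos n ha
  obtain ⟨q, hqdef⟩ : ∃ q, q = Real.exp (-|lam|) := ⟨_, rfl⟩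
  rw [← hqdef] at hq hq0
  have h1q2 : 0 < 1 - q ^ 2 := by nlinarith
  set N := cohNorm n |lam| with hNdef
  set P : ℝ := N * (Real.pi / ((1 - q) * |lam| / 2)) ^ n with hP
  have hPpos : 0 < P := by positivity
  set C₁ : ℝ := Real.exp (-(1 / 2) * n * |lam|) * ‖M‖ *
    (N * (Real.pi / ((1 - q ^ 2) * |lam| / 2)) ^ n) with hC₁
  refine ⟨P⁻¹ * C₁, by positivity, fun z => ?_⟩
  set κ : Phase n → Phase n → ℂ := fun v w => (cohWeight lam z w : ℂ) *
    ⟪coh (abs_pos.2 hlam) (tau lam w),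
      schrodinger lam v (coh (abs_pos.2 hlam) (contractedTau lam w))⟫_ℂ with hκ
  have hcont : Continuous (fun p : Phase n × Phase n => κ p.1 p.2) := by
    simp only [hκ, weighted_matrixCoeff_eq hlam]
    fun_prop
  have hint : Integrable (fun p : Phase n × Phase n => f p.1 * κ p.1 p.2)
      (volume.prod volume) := by
    have hm :=
      (integrable_mul_gaussian (Lp.memLp f) (show 0 < q * |lam| / 4 by positivity)).mul_prod
      ((integrable_phase_gaussian_real (show 0 < (1 - q) * |lam| / 4 by positivity)
        (fun i => -(lam * z (.inr i))) (fun i => lam * z (.inl i)) 0).const_mul N)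
    refine hm.mono' ((Lp.aestronglyMeasurable f).comp_fst.mul hcont.aestronglyMeasurable)
      (Filter.Eventually.of_forall fun p => ?_)
    rw [norm_mul, mul_assoc]
    have := norm_weighted_matrixCoeff_le hlam z p.1 p.2
    rw [← hqdef] at this
    exact mul_le_mul_of_nonneg_left this (norm_nonneg _)
  have hswap := integral_integral_swap (f := fun v w => f v * κ v w) hint
  have hleft : ∀ v, ∫ w, f v * κ v w = (P * Real.exp (|lam| / (2 * (1 - q)) * ‖z‖ ^ 2) : ℝ) *
      (f v * tiltedGaussian lam z v) := by
    intro v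
    rw [integral_const_mul, hκ, integral_weighted_matrixCoeff hlam, ← hqdef]
    ring
  have hright : ∀ w, ∫ v, f v * κ v w = (cohWeight lam z w : ℂ) *
      ((Real.exp (-(1 / 2) * n * |lam|) : ℂ) *
        ⟪coh (abs_pos.2 hlam) (contractedTau lam w),
          M (coh (abs_pos.2 hlam) (contractedTau lam w))⟫_ℂ) := by
    intro w
    have h := (hM (coh (abs_pos.2 hlam) (contractedTau lam w))
      (coh (abs_pos.2 hlam) (tau lam w))).2
    rw [ContinuousLinearMap.comp_apply, ← hermiteSemigroup_inner_left hlam one_half_pos,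
      hermiteSemigroup_half_coh_tau hlam, inner_smul_left, Complex.conj_ofReal] at h
    rw [← h, ← integral_const_mul]
    congr 1; ext v; simp only [hκ]; ring
  simp only [hleft, hright] at hswap
  rw [integral_const_mul] at hswap
  have hbound : ∀ w, ‖(cohWeight lam z w : ℂ) * ((Real.exp (-(1 / 2) * n * |lam|) : ℂ) *
        ⟪coh (abs_pos.2 hlam) (contractedTau lam w),
          M (coh (abs_pos.2 hlam) (contractedTau lam w))⟫_ℂ)‖ ≤
      (Real.exp (-(1 / 2) * n * |lam|) * ‖M‖ * N) * Real.exp (∑ i,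
        (-((1 - q ^ 2) * |lam| / 2) * (w (.inl i) ^ 2 + w (.inr i) ^ 2)
          + -(lam * z (.inr i)) * w (.inl i) + lam * z (.inl i) * w (.inr i) + 0)) := by
    intro w
    have h1 : ‖⟪coh (abs_pos.2 hlam) (contractedTau lam w),
          M (coh (abs_pos.2 hlam) (contractedTau lam w))⟫_ℂ‖ ≤
        ‖M‖ * ‖coh (abs_pos.2 hlam) (contractedTau lam w)‖ ^ 2 := by
      refine (norm_inner_le_norm _ _).trans ?_
      rw [pow_two, mul_left_comm]
      exact mul_le_mul_of_nonneg_left (M.le_opNorm _) (norm_nonneg _)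
    rw [norm_sq_coh hlam, ← hNdef] at h1
    have e : cohWeight lam z w * Real.exp (∑ i, ‖contractedTau lam w i‖ ^ 2 / (2 * |lam|)) =
        Real.exp (∑ i,
        (-((1 - q ^ 2) * |lam| / 2) * (w (.inl i) ^ 2 + w (.inr i) ^ 2)
          + -(lam * z (.inr i)) * w (.inl i) + lam * z (.inl i) * w (.inr i) + 0)) := by
      rw [cohWeight, ← Real.exp_add, ← Finset.sum_add_distrib]
      congr 1
      refine Finset.sum_congr rfl fun i _ => ?_
      rw [contractedTau, norm_mul, mul_pow, norm_sq_tau, Complex.norm_real, Real.norm_eq_abs,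
        sq_abs, ← hqdef]
      field_simp
      ring
    rw [← e, norm_mul, norm_mul, Complex.norm_real, Complex.norm_real, Real.norm_eq_abs,
      Real.norm_eq_abs, Real.abs_exp, abs_of_pos (show 0 < cohWeight lam z w from Real.exp_pos _)]
    have hw : 0 ≤ cohWeight lam z w * Real.exp (-(1 / 2) * n * |lam|) :=
      mul_nonneg (Real.exp_pos _).le (Real.exp_pos _).le
    calc _ ≤ (cohWeight lam z w * Real.exp (-(1 / 2) * n * |lam|)) *
          (‖M‖ * (N * Real.exp (∑ i, ‖contractedTau lam w i‖ ^ 2 / (2 * |lam|)))) := by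
          rw [← mul_assoc]
          exact mul_le_mul_of_nonneg_left h1 hw
      _ = _ := by ring
  have hb2 : 0 < (1 - q ^ 2) * |lam| / 2 := by positivity
  have hI := norm_integral_le_of_norm_le ((integrable_phase_gaussian_real hb2
        (fun i => -(lam * z (.inr i))) (fun i => lam * z (.inl i)) 0).const_mul
        (Real.exp (-(1 / 2) * n * |lam|) * ‖M‖ * N)) (Filter.Eventually.of_forall hbound)
  rw [← hswap, integral_const_mul, integral_phase_gaussian_real hb2, norm_mul, Complex.norm_real,
    Real.norm_eq_abs, abs_of_pos (by positivity)] at hI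
  have hexp : (∑ i, (((-(lam * z (.inr i))) ^ 2 + (lam * z (.inl i)) ^ 2) /
      (4 * ((1 - q ^ 2) * |lam| / 2)) + (0 : Fin n → ℝ) i)) =
      |lam| / (2 * (1 - q ^ 2)) * ‖z‖ ^ 2 := by
    rw [phase_norm_sq, Finset.mul_sum]
    refine Finset.sum_congr rfl fun i _ => ?_
    rw [neg_sq, mul_pow, mul_pow, ← sq_abs lam, Pi.zero_apply]
    field_simp
    ring
  rw [hexp] at hI
  rw [← hqdef, sub_mul, Real.exp_sub, ← mul_div_assoc, le_div_iff₀ (Real.exp_pos _),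
    mul_assoc P⁻¹, ← div_eq_inv_mul, le_div_iff₀ hPpos]
  calc _ = P * Real.exp (|lam| / (2 * (1 - q)) * ‖z‖ ^ 2) *
        ‖∫ v, f v * tiltedGaussian lam z v‖ := by ring
    _ ≤ _ := hI
    _ = _ := by rw [hC₁]; ring


theorem heatConst_pos (n : ℕ) {lam t : ℝ} (hlam : lam ≠ 0) (ht : 0 < t) :
    0 < heatConst n lam t := by
  have h : 0 < lam / Real.sinh (lam * t) := by
    rcases lt_or_gt_of_ne hlam with h | h
    · exact div_pos_of_neg_of_neg h (Real.sinh_neg_iff.2 (mul_neg_of_neg_of_pos h ht))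
    · exact div_pos h (Real.sinh_pos_iff.2 (mul_pos h ht))
  unfold heatConst
  positivity

theorem heatKernel_one_eq {n : ℕ} {lam : ℝ} (hlam : lam ≠ 0) (z : Phase n) :
    heatKernel lam 1 z = heatConst n lam 1 *
      Real.exp (-(|lam| / 4 * ((1 + Real.exp (-|lam|) ^ 2) / (1 - Real.exp (-|lam|) ^ 2))) *
        ‖z‖ ^ 2) := by
  have h := mul_coth_eq hlam one_pos
  have e : Real.exp (-2 * 1 * |lam|) = Real.exp (-|lam|) ^ 2 := by
    rw [← Real.exp_nat_mul]; congr 1; push_cast; ring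
  rw [e] at h
  rw [heatKernel, heatConst]
  congr 2
  linear_combination (-‖z‖ ^ 2 / 4) * h

/-- The pointwise bound `|U_lam f ∗ p_{1/2}| ≤ C p_1`. -/
theorem norm_twistedConv_heatKernel_le {n : ℕ} {lam : ℝ} (hlam : lam ≠ 0) (f : L2Phase n)
    (M : L2 n →L[ℂ] L2 n)
    (hM : IsWeylTransform lam f (hermiteSemigroup n lam (1 / 2) ∘L M)) :
    ∃ C : ℝ, 0 < C ∧ ∀ z : Phase n,
      ‖twistedConv lam (U lam f) (fun v => (heatKernel lam (1 / 2) v : ℂ)) z‖ ≤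
        C * heatKernel lam 1 z := by
  obtain ⟨K, hK⟩ := twistedConv_U_heatKernel (n := n) hlam
  obtain ⟨C, hC, hb⟩ := norm_integral_mul_tiltedGaussian_le hlam f M hM
  have hpos := heatConst_pos n hlam one_pos
  refine ⟨(‖K‖ * C + 1) / heatConst n lam 1, by positivity, fun z => ?_⟩
  have hq := exp_neg_abs_lt_one hlam
  have hq0 := Real.exp_pos (-|lam|)
  rw [hK, heatKernel_one_eq hlam, norm_mul, norm_mul, Complex.norm_real, Real.norm_eq_abs,
    Real.abs_exp, ← mul_assoc, div_mul_cancel₀ _ hpos.ne']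
  have hbz := hb z
  rw [cConst_half_eq hlam]
  generalize Real.exp (-|lam|) = q at *
  have e : Real.exp (-(lam ^ 2 / (8 * (|lam| / 2 * ((1 + q) / (1 - q))))) * ‖z‖ ^ 2) *
      Real.exp ((|lam| / (2 * (1 - q ^ 2)) - |lam| / (2 * (1 - q))) * ‖z‖ ^ 2) =
      Real.exp (-(|lam| / 4 * ((1 + q ^ 2) / (1 - q ^ 2))) * ‖z‖ ^ 2) := by
    rw [← Real.exp_add, ← sq_abs lam]
    congr 1
    have : 1 - q ^ 2 = (1 - q) * (1 + q) := by ring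
    rw [this]
    field_simp
    ring
  calc _ ≤ ‖K‖ * Real.exp (-(lam ^ 2 / (8 * (|lam| / 2 * ((1 + q) / (1 - q))))) * ‖z‖ ^ 2) *
        (C * Real.exp ((|lam| / (2 * (1 - q ^ 2)) - |lam| / (2 * (1 - q))) * ‖z‖ ^ 2)) :=
        mul_le_mul_of_nonneg_left hbz (by positivity)
    _ = ‖K‖ * C * Real.exp (-(|lam| / 4 * ((1 + q ^ 2) / (1 - q ^ 2))) * ‖z‖ ^ 2) := by
        rw [← e]; ring
    _ ≤ _ := by
        refine mul_le_mul_of_nonneg_right ?_ (Real.exp_pos _).le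
        linarith

theorem integrable_heatKernel_one {n : ℕ} {lam : ℝ} (hlam : lam ≠ 0) :
    Integrable (heatKernel lam 1 : Phase n → ℝ) := by
  have hq := exp_neg_abs_lt_one hlam
  have hq0 := Real.exp_pos (-|lam|)
  have hb : 0 < |lam| / 4 * ((1 + Real.exp (-|lam|) ^ 2) / (1 - Real.exp (-|lam|) ^ 2)) := by
    have : 0 < 1 - Real.exp (-|lam|) ^ 2 := by nlinarith
    positivity
  refine ((integrable_phase_gaussian_real hb 0 0 0).const_mul (heatConst n lam 1)).congr
    (Filter.Eventually.of_forall fun v => ?_)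
  simp only [heatKernel_one_eq hlam, phase_norm_sq, Finset.mul_sum, Pi.zero_apply, zero_mul,
    add_zero]

/-! ### The Weyl transform of the twisted convolution with the heat kernel -/

theorem stronglyMeasurable_U {n : ℕ} (lam : ℝ) (f : L2Phase n) : StronglyMeasurable (U lam f) := by
  unfold U intertwiner euclideanFourier
  have h : StronglyMeasurable fun v : Phase n =>
      (𝓕 f : L2Phase n) ((2 * Real.pi)⁻¹ • cConst lam (1 / 2) • v) :=
    (Lp.stronglyMeasurable (𝓕 f : L2Phase n)).comp_measurable
      (Continuous.measurable (by fun_prop))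
  exact (h.const_mul _).const_mul _

theorem memLp_U {n : ℕ} {lam : ℝ} (hlam : lam ≠ 0) (f : L2Phase n) : MemLp (U lam f) 2 := by
  have hc := cConst_half_pos hlam
  have hR : (2 * Real.pi)⁻¹ * cConst lam (1 / 2) ≠ 0 := by
    positivity
  unfold U intertwiner euclideanFourier
  refine MemLp.const_mul (MemLp.const_mul ?_ _) _
  have h : StronglyMeasurable fun v : Phase n =>
      (𝓕 f : L2Phase n) ((2 * Real.pi)⁻¹ • cConst lam (1 / 2) • v) :=
    (Lp.stronglyMeasurable (𝓕 f : L2Phase n)).comp_measurable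
      (Continuous.measurable (by fun_prop))
  rw [memLp_two_iff_integrable_sq_norm h.aestronglyMeasurable]
  have h2 := (Lp.memLp (𝓕 f : L2Phase n)).integrable_norm_pow (p := 2) two_ne_zero
  have h3 := h2.comp_smul hR
  simpa only [smul_smul] using h3

theorem norm_inner_coh_schrodinger {n : ℕ} {lam : ℝ} (hlam : lam ≠ 0) (θ η : Fin n → ℂ)
    (v : Phase n) :
    ‖⟪coh (abs_pos.2 hlam) θ, schrodinger lam v (coh (abs_pos.2 hlam) η)⟫_ℂ‖ =
      cohNorm n |lam| * Real.exp (∑ i, (-(|lam| / 4) * (v (.inl i) ^ 2 + v (.inr i) ^ 2)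
        + (Complex.I * lam * (conj (θ i) + η i) / (2 * |lam|)).re * v (.inl i)
        + ((η i - conj (θ i)) / 2).re * v (.inr i) + (conj (θ i) * η i / (2 * |lam|)).re)) := by
  have ha := abs_pos.2 hlam
  have ha0 : ((|lam| : ℝ) : ℂ) ≠ 0 := by exact_mod_cast ha.ne'
  rw [inner_coh_schrodinger hlam, norm_mul, Complex.norm_real, Real.norm_eq_abs,
    abs_of_pos (cohNorm_pos n ha), Complex.norm_exp, Complex.re_sum]
  congr 2
  refine Finset.sum_congr rfl fun i _ => ?_
  have e : conj (θ i) * η i / (2 * |lam| : ℝ)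
        - (|lam| / 4 : ℝ) * ((v (.inl i) : ℂ) ^ 2 + (v (.inr i) : ℂ) ^ 2)
        + (conj (θ i) * (-|lam| * v (.inr i) + Complex.I * lam * v (.inl i))
          - η i * (-|lam| * v (.inr i) - Complex.I * lam * v (.inl i))) / (2 * |lam| : ℝ) =
      ((-(|lam| / 4) * (v (.inl i) ^ 2 + v (.inr i) ^ 2) : ℝ) : ℂ)
        + (Complex.I * lam * (conj (θ i) + η i) / (2 * |lam|)) * v (.inl i)
        + ((η i - conj (θ i)) / 2) * v (.inr i) + conj (θ i) * η i / (2 * |lam|) := by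
    push_cast
    field_simp
    ring
  rw [e, Complex.add_re, Complex.add_re, Complex.add_re, Complex.ofReal_re, Complex.re_mul_ofReal,
    Complex.re_mul_ofReal]

/-- The identity `π_lam(w) π_lam(p_{1/2}) = π_lam(w) exp (- H(lam) / 2)` between coherent states;
the left side is written as an integral over `v`, the sum of `w` and the variable of `p_{1/2}`. -/
theorem integral_heatKernel_matrixCoeff {n : ℕ} {lam : ℝ} (hlam : lam ≠ 0) (θ η : Fin n → ℂ)
    (w : Phase n) :
    ∫ v, (heatKernel lam (1 / 2) (v - w) : ℂ) *
        Complex.exp (Complex.I * (lam / 2 * imForm v (v - w) : ℝ)) *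
        ⟪coh (abs_pos.2 hlam) θ, schrodinger lam v (coh (abs_pos.2 hlam) η)⟫_ℂ =
      (Real.exp (-(1 / 2) * n * |lam|) : ℂ) * ⟪coh (abs_pos.2 hlam) θ,
        schrodinger lam w (coh (abs_pos.2 hlam) fun i => (Real.exp (-|lam|) : ℂ) * η i)⟫_ℂ := by
  have ha := abs_pos.2 hlam
  have hq := exp_neg_abs_lt_one hlam
  have ha0 : ((|lam| : ℝ) : ℂ) ≠ 0 := by exact_mod_cast ha.ne'
  have hsq : (lam : ℂ) ^ 2 = ((|lam| : ℝ) : ℂ) ^ 2 := by norm_cast; exact (sq_abs lam).symm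
  have hconst : heatConst n lam (1 / 2) * (Real.pi / (|lam| / (2 * (1 - Real.exp (-|lam|))))) ^ n =
      Real.exp (-(1 / 2) * n * |lam|) := by
    have h1 : lam / Real.sinh (lam * (1 / 2)) = |lam| / Real.sinh (|lam| * (1 / 2)) := by
      rcases abs_cases lam with ⟨h, _⟩ | ⟨h, _⟩ <;> rw [h]
      rw [neg_mul lam, Real.sinh_neg, neg_div_neg_eq]
    have h2 : Real.exp (-(1 / 2) * n * |lam|) = (Real.exp (-(|lam| * (1 / 2)))) ^ n := by
      rw [← Real.exp_nat_mul]; congr 1; ring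
    have h3 : Real.exp (-|lam|) = Real.exp (-(|lam| * (1 / 2))) ^ 2 := by
      rw [← Real.exp_nat_mul]; congr 1; push_cast; ring
    have h4 : Real.exp (|lam| * (1 / 2)) = (Real.exp (-(|lam| * (1 / 2))))⁻¹ := by
      rw [Real.exp_neg, inv_inv]
    rw [h2, heatConst, h1, ← inv_pow, ← mul_pow, ← mul_pow, Real.sinh_eq, h4, h3]
    rw [h3] at hq
    generalize Real.exp (-(|lam| * (1 / 2))) = s at *
    have h5 : 1 - s ^ 2 ≠ 0 := by linarith
    congr 1
    have h6 : s⁻¹ - s = (1 - s ^ 2) / s := by field_simp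
    rw [h6]
    field_simp
    ring
  have hb : 0 < |lam| / (2 * (1 - Real.exp (-|lam|))) := by
    positivity
  have hcr := cConst_half_eq hlam
  set c := cConst lam (1 / 2) with hc
  have h := integral_phase_gaussian hb
    (fun i => c * w (.inl i) + Complex.I * lam / 2 * w (.inr i) +
      Complex.I * lam * (conj (θ i) + η i) / (2 * |lam|))
    (fun i => c * w (.inr i) - Complex.I * lam / 2 * w (.inl i) + (η i - conj (θ i)) / 2)
    (fun i => conj (θ i) * η i / (2 * |lam|) -
      c / 2 * ((w (.inl i) : ℂ) ^ 2 + (w (.inr i) : ℂ) ^ 2))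
  have hint : ∀ v : Phase n, (heatKernel lam (1 / 2) (v - w) : ℂ) *
        Complex.exp (Complex.I * (lam / 2 * imForm v (v - w) : ℝ)) *
        ⟪coh (abs_pos.2 hlam) θ, schrodinger lam v (coh (abs_pos.2 hlam) η)⟫_ℂ =
      (heatConst n lam (1 / 2) * cohNorm n |lam| : ℂ) * Complex.exp (∑ i,
        (-(|lam| / (2 * (1 - Real.exp (-|lam|))) : ℝ) *
          ((v (.inl i) : ℂ) ^ 2 + (v (.inr i) : ℂ) ^ 2) +
        (c * w (.inl i) + Complex.I * lam / 2 * w (.inr i) +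
          Complex.I * lam * (conj (θ i) + η i) / (2 * |lam|)) * v (.inl i) +
        (c * w (.inr i) - Complex.I * lam / 2 * w (.inl i) + (η i - conj (θ i)) / 2) *
          v (.inr i) +
        (conj (θ i) * η i / (2 * |lam|) -
          c / 2 * ((w (.inl i) : ℂ) ^ 2 + (w (.inr i) : ℂ) ^ 2)))) := by
    intro v
    have hb' : |lam| / (2 * (1 - Real.exp (-|lam|))) = c / 2 + |lam| / 4 := by
      rw [hcr]
      have : 1 - Real.exp (-|lam|) ≠ 0 := by linarith
      field_simp
      ring
    have hmul : ∀ A B e₁ e₂ e₃ : ℂ, A * Complex.exp e₁ * Complex.exp e₂ * (B * Complex.exp e₃) =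
        A * B * Complex.exp (e₁ + e₂ + e₃) := by
      intro A B e₁ e₂ e₃
      rw [Complex.exp_add, Complex.exp_add]; ring
    rw [heatKernel_half_eq, inner_coh_schrodinger hlam, imForm_eq_sum, hmul, hb', ← hc]
    push_cast
    rw [Finset.mul_sum, Finset.mul_sum, ← Finset.sum_add_distrib, ← Finset.sum_add_distrib]
    congr 2
    refine Finset.sum_congr rfl fun i _ => ?_
    simp only [PiLp.sub_apply]
    push_cast
    field_simp
    ring
  simp only [hint]
  rw [integral_const_mul, h, inner_coh_schrodinger hlam, ← hconst]
  have hexp : (∑ i, (((c * w (.inl i) + Complex.I * lam / 2 * w (.inr i) +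
        Complex.I * lam * (conj (θ i) + η i) / (2 * |lam|)) ^ 2 +
      (c * w (.inr i) - Complex.I * lam / 2 * w (.inl i) + (η i - conj (θ i)) / 2) ^ 2) /
        (4 * (|lam| / (2 * (1 - Real.exp (-|lam|))) : ℝ)) +
      (conj (θ i) * η i / (2 * |lam|) -
        c / 2 * ((w (.inl i) : ℂ) ^ 2 + (w (.inr i) : ℂ) ^ 2)))) =
      ∑ i, (conj (θ i) * ((Real.exp (-|lam|) : ℂ) * η i) / (2 * |lam| : ℝ)
        - (|lam| / 4 : ℝ) * ((w (.inl i) : ℂ) ^ 2 + (w (.inr i) : ℂ) ^ 2)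
        + (conj (θ i) * (-|lam| * w (.inr i) + Complex.I * lam * w (.inl i))
          - (Real.exp (-|lam|) : ℂ) * η i * (-|lam| * w (.inr i) - Complex.I * lam * w (.inl i))) /
          (2 * |lam| : ℝ)) := by
    refine Finset.sum_congr rfl fun i _ => ?_
    rw [hcr]
    generalize Real.exp (-|lam|) = q at *
    have hq1 : (1 - q : ℂ) ≠ 0 := by norm_cast; exact (by linarith : 0 < 1 - q).ne'
    push_cast
    field_simp
    ring_nf
    simp only [Complex.I_sq, hsq]
    ring
  rw [hexp]
  push_cast
  ring


theorem integrable_mul_inner_schrodinger {n : ℕ} (lam : ℝ) {g : Phase n → ℂ} (hg : Integrable g)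
    (φ ψ : L2 n) : Integrable fun v => g v * ⟪ψ, schrodinger lam v φ⟫_ℂ :=
  hg.mul_bdd (c := ‖ψ‖ * ‖φ‖)
    (stronglyMeasurable_inner_schrodinger lam φ ψ).aestronglyMeasurable
    (Filter.Eventually.of_forall fun v =>
      (norm_inner_le_norm _ _).trans_eq (by rw [norm_schrodinger]))

theorem norm_integral_mul_inner_schrodinger_le {n : ℕ} (lam : ℝ) {g : Phase n → ℂ}
    (hg : Integrable g) (φ ψ : L2 n) :
    ‖∫ v, g v * ⟪ψ, schrodinger lam v φ⟫_ℂ‖ ≤ (∫ v, ‖g v‖) * (‖ψ‖ * ‖φ‖) := by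
  rw [← integral_mul_const]
  refine norm_integral_le_of_norm_le (hg.norm.mul_const _) (Filter.Eventually.of_forall fun v => ?_)
  rw [norm_mul]
  exact mul_le_mul_of_nonneg_left
    ((norm_inner_le_norm _ _).trans_eq (by rw [norm_schrodinger])) (norm_nonneg _)

/-- For an integrable symbol, the Weyl transform is determined by its matrix coefficients between
coherent states. -/
theorem isWeylTransform_of_coh {n : ℕ} {lam a : ℝ} (ha : 0 < a) {g : Phase n → ℂ}
    (hg : Integrable g) (T : L2 n →L[ℂ] L2 n)
    (h : ∀ θ η : Fin n → ℂ, ∫ v, g v * ⟪coh ha θ, schrodinger lam v (coh ha η)⟫_ℂ =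
      ⟪coh ha θ, T (coh ha η)⟫_ℂ) : IsWeylTransform lam g T := by
  have step : ∀ (θ : Fin n → ℂ) (φ : L2 n), ∫ v, g v * ⟪coh ha θ, schrodinger lam v φ⟫_ℂ =
      ⟪coh ha θ, T φ⟫_ℂ := by
    intro θ φ
    let A : L2 n →L[ℂ] ℂ := LinearMap.mkContinuous
      { toFun := fun φ => ∫ v, g v * ⟪coh ha θ, schrodinger lam v φ⟫_ℂ
        map_add' := fun φ₁ φ₂ => by
          simp only [schrodinger_add, inner_add_right, mul_add]
          exact integral_add (integrable_mul_inner_schrodinger lam hg _ _)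
            (integrable_mul_inner_schrodinger lam hg _ _)
        map_smul' := fun c φ => by
          simp only [schrodinger_smul, inner_smul_right, RingHom.id_apply, smul_eq_mul,
            mul_left_comm _ c]
          exact integral_const_mul _ _ } ((∫ v, ‖g v‖) * ‖coh ha θ‖) fun φ =>
        (norm_integral_mul_inner_schrodinger_le lam hg φ _).trans_eq (mul_assoc _ _ _).symm
    have hA : A = innerSL ℂ (coh ha θ) ∘L T := by
      refine ContinuousLinearMap.ext_on (dense_span_coh ha) ?_
      rintro _ ⟨η, rfl⟩
      exact h θ η
    exact DFunLike.congr_fun hA φ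
  refine fun φ ψ => ⟨integrable_mul_inner_schrodinger lam hg φ ψ, ?_⟩
  -- The conjugate of the left side is linear in `ψ`.
  let B : L2 n →L[ℂ] ℂ := LinearMap.mkContinuous
    { toFun := fun ψ => conj (∫ v, g v * ⟪ψ, schrodinger lam v φ⟫_ℂ)
      map_add' := fun ψ₁ ψ₂ => by
        simp only [inner_add_left, mul_add]
        rw [integral_add (integrable_mul_inner_schrodinger lam hg _ _)
          (integrable_mul_inner_schrodinger lam hg _ _), map_add]
      map_smul' := fun c ψ => by
        simp only [inner_smul_left, RingHom.id_apply, smul_eq_mul, mul_left_comm _ (conj c)]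
        rw [integral_const_mul, map_mul, Complex.conj_conj] } ((∫ v, ‖g v‖) * ‖φ‖) fun ψ => by
      rw [LinearMap.coe_mk, AddHom.coe_mk, RCLike.norm_conj]
      exact (norm_integral_mul_inner_schrodinger_le lam hg φ ψ).trans_eq (by ring)
  have hB : B = innerSL ℂ (T φ) := by
    refine ContinuousLinearMap.ext_on (dense_span_coh ha) ?_
    rintro _ ⟨θ, rfl⟩
    change conj (∫ v, g v * ⟪coh ha θ, schrodinger lam v φ⟫_ℂ) = ⟪T φ, coh ha θ⟫_ℂ
    rw [step, inner_conj_symm]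
  have hψ : conj (∫ v, g v * ⟪ψ, schrodinger lam v φ⟫_ℂ) = ⟪T φ, ψ⟫_ℂ := DFunLike.congr_fun hB ψ
  rw [← inner_conj_symm, ← hψ, Complex.conj_conj]

theorem continuous_heatKernel {n : ℕ} (lam t : ℝ) :
    Continuous (heatKernel lam t : Phase n → ℝ) := by
  unfold heatKernel; fun_prop

theorem continuous_imForm {n : ℕ} : Continuous fun p : Phase n × Phase n => imForm p.1 p.2 := by
  simp only [imForm_eq_sum]; fun_prop

theorem stronglyMeasurable_twistedConv {n : ℕ} (lam : ℝ) {F G : Phase n → ℂ}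
    (hF : StronglyMeasurable F) (hG : Continuous G) : StronglyMeasurable (twistedConv lam F G) := by
  unfold twistedConv
  refine StronglyMeasurable.integral_prod_right (f := fun z w => F (z - w) * G w *
    Complex.exp (Complex.I * (lam / 2 * imForm z w : ℝ))) ?_
  have h1 : StronglyMeasurable fun p : Phase n × Phase n => F (p.1 - p.2) :=
    hF.comp_measurable (Continuous.measurable (by fun_prop))
  have h2 : Continuous fun p : Phase n × Phase n => G p.2 *
      Complex.exp (Complex.I * (lam / 2 * imForm p.1 p.2 : ℝ)) := by
    have := continuous_imForm (n := n)
    fun_prop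
  simp only [Function.uncurry_def, mul_assoc]
  exact h1.mul h2.stronglyMeasurable

/-- A majorant in which the variables `v` and `w` are separated, for Fubini's theorem. -/
theorem norm_heatKernel_mul_matrixCoeff_le {n : ℕ} {lam : ℝ} (hlam : lam ≠ 0) (θ η : Fin n → ℂ)
    (v w : Phase n) :
    ‖(heatKernel lam (1 / 2) (v - w) : ℂ) *
        Complex.exp (Complex.I * (lam / 2 * imForm v (v - w) : ℝ)) *
        ⟪coh (abs_pos.2 hlam) θ, schrodinger lam v (coh (abs_pos.2 hlam) η)⟫_ℂ‖ ≤
      Real.exp (∑ i, (-(|lam| / 16) * (w (.inl i) ^ 2 + w (.inr i) ^ 2))) *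
      (heatConst n lam (1 / 2) * cohNorm n |lam| * Real.exp (∑ i,
        (-(|lam| / 8) * (v (.inl i) ^ 2 + v (.inr i) ^ 2)
        + (Complex.I * lam * (conj (θ i) + η i) / (2 * |lam|)).re * v (.inl i)
        + ((η i - conj (θ i)) / 2).re * v (.inr i) + (conj (θ i) * η i / (2 * |lam|)).re))) := by
  have ha := abs_pos.2 hlam
  have hN := cohNorm_pos n ha
  have hH := heatConst_pos n hlam one_half_pos
  have hc : |lam| / 2 ≤ cConst lam (1 / 2) := by
    have hq := exp_neg_abs_lt_one hlam
    have hq0 := Real.exp_pos (-|lam|)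
    rw [cConst_half_eq hlam]
    refine le_mul_of_one_le_right (by positivity) ?_
    rw [one_le_div (by linarith)]
    linarith
  rw [norm_mul, norm_mul, norm_inner_coh_schrodinger hlam, mul_comm Complex.I,
    Complex.norm_exp_ofReal_mul_I, mul_one, heatKernel_half_eq, norm_mul, Complex.norm_real,
    Real.norm_eq_abs, abs_of_pos hH, Complex.norm_exp, Complex.re_sum, mul_mul_mul_comm,
    mul_left_comm (Real.exp _), ← Real.exp_add, ← Real.exp_add, ← Finset.sum_add_distrib,
    ← Finset.sum_add_distrib]
  refine mul_le_mul_of_nonneg_left (Real.exp_le_exp.2 (Finset.sum_le_sum fun i _ => ?_))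
    (by positivity)
  have e : (-(cConst lam (1 / 2) / 2 : ℝ) * (((v - w) (.inl i) : ℂ) ^ 2 +
      ((v - w) (.inr i) : ℂ) ^ 2)).re = -(cConst lam (1 / 2) / 2) *
      ((v (.inl i) - w (.inl i)) ^ 2 + (v (.inr i) - w (.inr i)) ^ 2) := by
    simp only [PiLp.sub_apply]
    norm_cast
  rw [e]
  have key : ∀ x y : ℝ, |lam| / 16 * y ^ 2 + |lam| / 8 * x ^ 2 ≤
      cConst lam (1 / 2) / 2 * (x - y) ^ 2 + |lam| / 4 * x ^ 2 := by
    intro x y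
    nlinarith [mul_nonneg (sub_nonneg.2 hc) (sq_nonneg (x - y)),
      mul_nonneg ha.le (sq_nonneg (x - y)), mul_nonneg ha.le (sq_nonneg (2 * x - y))]
  linarith [key (v (.inl i)) (w (.inl i)), key (v (.inr i)) (w (.inr i))]

/-- The Weyl transform turns the twisted convolution with `p_{1/2}` into the multiplication by
`exp (- H(lam) / 2)` on the right. -/
theorem isWeylTransform_twistedConv_heatKernel {n : ℕ} {lam : ℝ} (hlam : lam ≠ 0)
    {F : Phase n → ℂ} (hFm : StronglyMeasurable F) (hF2 : MemLp F 2) {T : L2 n →L[ℂ] L2 n}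
    (hT : IsWeylTransform lam F T)
    (hint : Integrable (twistedConv lam F fun v => (heatKernel lam (1 / 2) v : ℂ))) :
    IsWeylTransform lam (twistedConv lam F fun v => (heatKernel lam (1 / 2) v : ℂ))
      (T ∘L hermiteSemigroup n lam (1 / 2)) := by
  have ha := abs_pos.2 hlam
  refine isWeylTransform_of_coh ha hint _ fun θ η => ?_
  set κ : Phase n → Phase n → ℂ := fun v w => (heatKernel lam (1 / 2) (v - w) : ℂ) *
        Complex.exp (Complex.I * (lam / 2 * imForm v (v - w) : ℝ)) *
        ⟪coh (abs_pos.2 hlam) θ, schrodinger lam v (coh (abs_pos.2 hlam) η)⟫_ℂ with hκ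
  have hcont : Continuous fun p : Phase n × Phase n => κ p.2 p.1 := by
    have h1 := continuous_heatKernel (n := n) lam (1 / 2)
    simp only [hκ, inner_coh_schrodinger hlam, imForm_eq_sum]
    fun_prop
  have hleft : ∀ v, twistedConv lam F (fun v => (heatKernel lam (1 / 2) v : ℂ)) v *
      ⟪coh ha θ, schrodinger lam v (coh ha η)⟫_ℂ = ∫ w, F w * κ v w := by
    intro v
    rw [twistedConv, ← integral_sub_left_eq_self _ volume v, ← integral_mul_const]
    congr 1; ext w
    simp only [sub_sub_cancel, hκ]
    ring
  have hi : Integrable (fun p : Phase n × Phase n => F p.1 * κ p.2 p.1) (volume.prod volume) := by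
    have hg := integrable_mul_gaussian hF2 (show 0 < |lam| / 16 by positivity)
    have hm := hg.mul_prod ((integrable_phase_gaussian_real (show 0 < |lam| / 8 by positivity)
      (fun i => (Complex.I * lam * (conj (θ i) + η i) / (2 * |lam|)).re)
      (fun i => ((η i - conj (θ i)) / 2).re)
      (fun i => (conj (θ i) * η i / (2 * |lam|)).re)).const_mul
        (heatConst n lam (1 / 2) * cohNorm n |lam|))
    refine hm.mono' (hFm.aestronglyMeasurable.comp_fst.mul hcont.aestronglyMeasurable)
      (Filter.Eventually.of_forall fun p => ?_)
    rw [norm_mul, mul_assoc]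
    exact mul_le_mul_of_nonneg_left (norm_heatKernel_mul_matrixCoeff_le hlam θ η p.2 p.1)
      (norm_nonneg _)
  have hswap := integral_integral_swap (f := fun w v => F w * κ v w) hi
  simp only [hleft]
  rw [← hswap]
  simp only [integral_const_mul, hκ, integral_heatKernel_matrixCoeff hlam]
  rw [ContinuousLinearMap.comp_apply, hermiteSemigroup_coh hlam one_half_pos, map_smul,
    inner_smul_right]
  have e : -2 * (1 / 2) * |lam| = -|lam| := by ring
  rw [e, ← (hT _ _).2, ← integral_const_mul]
  congr 1; ext w; ring

end

end TwistedFock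

theorem proposition4p2 (n : ℕ) (lam : ℝ) (hlam : lam ≠ 0)
    (f : TwistedFock.L2Phase n)
    (M₁ : TwistedFock.L2 n →L[ℂ] TwistedFock.L2 n)
    (hM₁ : TwistedFock.IsWeylTransform lam f
      (TwistedFock.hermiteSemigroup n lam (1 / 2) ∘L M₁))
    (g : TwistedFock.Phase n → ℂ)
    (hg : g = TwistedFock.twistedConv lam (TwistedFock.U lam f)
      (fun v => (TwistedFock.heatKernel lam (1 / 2) v : ℂ))) :
    (∃ C : ℝ, 0 < C ∧ ∀ x u : TwistedFock.Conf n,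
      ‖g (TwistedFock.mkPhase x u)‖ ≤ C * TwistedFock.heatKernel lam 1 (TwistedFock.mkPhase x u)) ∧
    ∀ M₂ : TwistedFock.L2 n →L[ℂ] TwistedFock.L2 n,
      TwistedFock.IsWeylTransform lam (TwistedFock.U lam f)
        (TwistedFock.hermiteSemigroup n lam (1 / 2) ∘L M₂) →
      TwistedFock.CommutesWith M₂ (TwistedFock.hermiteOp n lam) →
      ∃ T : TwistedFock.L2 n →L[ℂ] TwistedFock.L2 n,
        TwistedFock.IsWeylTransform lam g T ∧
        ∃ C : ℝ, 0 < C ∧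
          ContinuousLinearMap.adjoint T ∘L T ≤
            (C : ℂ) • TwistedFock.hermiteSemigroup n lam 2 := by
  open TwistedFock in
  obtain ⟨C, hC, hb⟩ := norm_twistedConv_heatKernel_le hlam f M₁ hM₁
  rw [← hg] at hb
  refine ⟨⟨C, hC, fun x u => hb _⟩, fun M₂ hM₂ hcomm => ?_⟩
  have hmeas : StronglyMeasurable g := by
    rw [hg]
    exact stronglyMeasurable_twistedConv lam (stronglyMeasurable_U lam f)
      (Complex.continuous_ofReal.comp (continuous_heatKernel lam (1 / 2)))
  have hint : Integrable g := ((integrable_heatKernel_one hlam).const_mul C).mono'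
    hmeas.aestronglyMeasurable (Filter.Eventually.of_forall hb)
  have hW := isWeylTransform_twistedConv_heatKernel hlam (stronglyMeasurable_U lam f)
    (memLp_U hlam f) hM₂ (hg ▸ hint)
  rw [← hg] at hW
  refine ⟨_, hW, ‖M₂‖ ^ 2 + 1, by positivity, ?_⟩
  have hT : (hermiteSemigroup n lam (1 / 2) ∘L M₂) ∘L hermiteSemigroup n lam (1 / 2) =
      M₂ ∘L hermiteSemigroup n lam 1 := by
    rw [hcomm.comp_hermiteSemigroup hlam one_half_pos, ContinuousLinearMap.comp_assoc,
      hermiteSemigroup_comp hlam one_half_pos one_half_pos, add_halves]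
  have h2 : hermiteSemigroup n lam 2 = hermiteSemigroup n lam 1 ∘L hermiteSemigroup n lam 1 := by
    rw [hermiteSemigroup_comp hlam one_pos one_pos, one_add_one_eq_two]
  rw [hT, h2, ContinuousLinearMap.le_def, ContinuousLinearMap.isPositive_iff_complex]
  intro φ
  have key : ⟪((((‖M₂‖ ^ 2 + 1 : ℝ) : ℂ) •
        (hermiteSemigroup n lam 1 ∘L hermiteSemigroup n lam 1)) -
        (M₂ ∘L hermiteSemigroup n lam 1).adjoint ∘L (M₂ ∘L hermiteSemigroup n lam 1)) φ, φ⟫_ℂ =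
      (((‖M₂‖ ^ 2 + 1) * ‖hermiteSemigroup n lam 1 φ‖ ^ 2 -
        ‖M₂ (hermiteSemigroup n lam 1 φ)‖ ^ 2 : ℝ) : ℂ) := by
    rw [sub_apply, inner_sub_left, smul_apply,
      inner_smul_left, ContinuousLinearMap.comp_apply, ContinuousLinearMap.comp_apply,
      ContinuousLinearMap.adjoint_inner_left, hermiteSemigroup_inner_left hlam one_pos,
      ContinuousLinearMap.comp_apply, inner_self_eq_norm_sq_to_K, inner_self_eq_norm_sq_to_K,
      Complex.conj_ofReal]
    push_cast
    rfl
  rw [key]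
  refine ⟨by rw [RCLike.re_to_complex, Complex.ofReal_re], ?_⟩
  rw [RCLike.re_to_complex, Complex.ofReal_re]
  have h3 := pow_le_pow_left₀ (norm_nonneg _) (M₂.le_opNorm (hermiteSemigroup n lam 1 φ)) 2
  rw [mul_pow] at h3
  nlinarith [sq_nonneg ‖hermiteSemigroup n lam 1 φ‖]
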